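/- Let $k,R>0$ with $kR\ge 2$, let $B_R=\{x\in\mathbb R^3:|x|<R\}$ and $r=|x|$, $\sigma=x/|x|$. For $f\in L^2(\mathbb S^2)$ let $a_n(f)=\bigl(\sum_{m=-n}^{n}|\langle f,Y_n^m\rangle|^2\bigr)^{1/2}$, where $(Y_n^m)$ is an orthonormal basis of $L^2(\mathbb S^2)$ formed of spherical harmonics, $Y_n^m$ having degree $n$; for functions on $\partial B_R$, regarded as functions of $\sigma$, put $$\|f\|_{(l)}^2(\partial B_R)=R^2\sum_{j=0}^{l}\sum_{n=0}^{\infty}\Bigl(\frac nR\Bigr)^{2j}a_n(f)^2 .$$ Let $u_0(x)=\dfrac{R}{e^{ikR}}\dfrac{e^{ikr}}{r}$ be the spherical wave, i.e. the radiating solution outside $\bar B_R$ with $u_0=1$ on $\partial B_R$. Let $d$ be a real-valued function in $H^1$ of the sphere and let $v_0$ be a solution of the soft (Dirichlet) obstacle problem linearized around $B_R$: $$\Delta v_0+k^2v_0=0\ \text{ in }\ \mathbb R^3\setminus\bar B_R,\qquad v_0=-d\,\partial_r u_0\ \text{ on }\ \partial B_R,\qquad \lim_{r\to\infty} r(\partial_r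 v_0-ikv_0)=0 \text{ uniformly in } \sigma,$$ where $v_0$ is $C^2$ outside $\bar B_R$ and takes its boundary values in the $L^2$ sense (i.e. $v_0(\rho\,\cdot)\to -d\,\partial_r u_0(R\,\cdot)$ in $L^2(\mathbb S^2)$ as $\rho\to R^+$). Let $A=A(v_0)$ be its scattering amplitude, $v_0(x)=\frac{e^{ikr}}{r}A(\sigma)+O(r^{-2})$ as $r\to\infty$, uniformly in $\sigma$. Put $N=\lfloor\sqrt{kR}\rfloor$ and $$\varepsilon_1^2=\sum_{n=0}^{N}a_n(A)^2,\qquad \varepsilon_2^2=\sum_{n=N+1}^{\infty}a_n(A)^2,\qquad E=-\log\varepsilon_2 ,$$ and assume $\varepsilon_2\le 1$, i.e. $E\ge 0$ (if $\varepsilon_2=0$, then $E=\infty$ and $1/(E+k)=0$). Then $$\|d\|^2_{(0)}(\partial B_R)\le\frac{R^2}{k^2R^2+1}\Bigl(\frac{2e^2}{\pi}\varepsilon_1^2+\frac2\pi e^{2/R}\varepsilon_2\Bigr)+R^2\frac{\|d\|^2_{(1)}(\partial B_R)}{E+k},$$ $$\|d\|^2_{(0)}(\partial B_R)\le\frac{R^2}{k^2R^2+1}\Bigl(\frac{2e^2}{\pi}\varepsilon_1^2+\sqrt{\frac{2(k^2R^2+1)}{\pi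 kR}}\,e^{1/R}\varepsilon_2^{1/2}\Bigr)+R^2\frac{\|d\|^2_{(1)}(\partial B_R)}{E+k},$$ and also $$\|d\|^2_{(0)}(\partial B_R)\le\frac{R^2}{k^2R^2+1}\Bigl(\frac{2e^2}{\pi}\varepsilon_1^2+\sqrt{\frac{2(k^2R^2+1)}{\pi kR}}\,e^{1/R}\,\|d\|_{(1)}(\partial B_R)\,\varepsilon_2^{1/2}\Bigr)+R^2\frac{\|d\|^2_{(1)}(\partial B_R)}{E+k}.$$ -/

import Mathlib

open MeasureTheory Filter Topology
open scoped ENNReal ContDiff Laplacian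

noncomputable section

namespace FarField

/-- Euclidean three-space. -/
abbrev E3 : Type := EuclideanSpace ℝ (Fin 3)

/-- The unit sphere of `ℝ³`. -/
abbrev S2 : Type := Metric.sphere (0 : E3) 1

/-- The surface measure of the unit sphere (total mass `4π`). -/
abbrev surf : Measure S2 := (volume : Measure E3).toSphere

/-! ### Spherical harmonics -/

/-- The Laplace operator `∑ i, ∂ᵢ²` on complex polynomials in three variables. -/
def polyLaplacian : MvPolynomial (Fin 3) ℂ →ₗ[ℂ] MvPolynomial (Fin 3) ℂ :=
  ∑ i : Fin 3, (MvPolynomial.pderiv i).toLinearMap ∘ₗ (MvPolynomial.pderiv i).toLinearMap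

/-- Harmonic polynomials that are homogeneous of degree `n`. -/
def harmonicPoly (n : ℕ) : Submodule ℂ (MvPolynomial (Fin 3) ℂ) :=
  MvPolynomial.homogeneousSubmodule (Fin 3) ℂ n ⊓ LinearMap.ker polyLaplacian

/-- Restriction of a polynomial to the unit sphere. -/
def restrictSphere : MvPolynomial (Fin 3) ℂ →ₗ[ℂ] C(S2, ℂ) where
  toFun p := ⟨fun σ => MvPolynomial.eval (fun i => ((σ.1 i : ℝ) : ℂ)) p, by
    refine (MvPolynomial.continuous_eval p).comp ?_
    fun_prop⟩
  map_add' p q := by ext; simp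
  map_smul' c p := by ext; simp

/-- The space of spherical harmonics of degree `n`, as a subspace of `L²(S²)`. -/
def sphericalHarmonics (n : ℕ) : Submodule ℂ (Lp ℂ 2 surf) :=
  (harmonicPoly n).map
    ((ContinuousMap.toLp (2 : ℝ≥0∞) surf ℂ).toLinearMap ∘ₗ restrictSphere)

instance finiteDimensional_sphericalHarmonics (n : ℕ) :
    FiniteDimensional ℂ (sphericalHarmonics n) := by
  have h1 : FiniteDimensional ℂ (MvPolynomial.homogeneousSubmodule (Fin 3) ℂ n) :=
    Module.Finite.iff_fg.mpr (MvPolynomial.homogeneousSubmodule_fg (σ := Fin 3) (R := ℂ) n)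
  have h2 : FiniteDimensional ℂ (harmonicPoly n) :=
    Submodule.finiteDimensional_of_le inf_le_left
  unfold sphericalHarmonics
  infer_instance

/-- `Y n m`, with `m` running through `dim = 2 n + 1` indices: an orthonormal basis of the space
of spherical harmonics of degree `n`.  The quantities defined from it below depend only on the
space, not on the chosen basis. -/
def Y (n : ℕ) (m : Fin (Module.finrank ℂ (sphericalHarmonics n))) : S2 → ℂ :=
  ((stdOrthonormalBasis ℂ (sphericalHarmonics n) m : sphericalHarmonics n) : Lp ℂ 2 surf)

/-- The coefficient of `f` with respect to `Y n m`. -/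
def coeff (f : S2 → ℂ) (n : ℕ) (m : Fin (Module.finrank ℂ (sphericalHarmonics n))) : ℂ :=
  ∫ σ, f σ * starRingEnd ℂ (Y n m σ) ∂surf

/-- `aₙ(f) = (∑ₘ |aₘₙ|²)^(1/2)`: the size of the degree `n` part of `f`. -/
def degreeSize (f : S2 → ℂ) (n : ℕ) : ℝ :=
  Real.sqrt (∑ m, ‖coeff f n m‖ ^ 2)

/-! ### Sobolev norms on the sphere of radius `R` -/

/-- The square of the norm `‖f‖₍ₗ₎(∂B_R)`.  A function on `∂B_R` is given as
`σ ↦ f (R σ)` on the unit sphere. -/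
def sobolevNormSq (l : ℕ) (R : ℝ) (f : S2 → ℂ) : ℝ :=
  R ^ 2 * ∑ j ∈ Finset.range (l + 1), ∑' n : ℕ, ((n : ℝ) / R) ^ (2 * j) * degreeSize f n ^ 2

/-- The norm `‖f‖₍ₗ₎(∂B_R)`. -/
def sobolevNorm (l : ℕ) (R : ℝ) (f : S2 → ℂ) : ℝ :=
  Real.sqrt (sobolevNormSq l R f)

/-- Membership in the Sobolev space `H¹` of the sphere. -/
def MemH1 (f : S2 → ℂ) : Prop :=
  MemLp f 2 surf ∧ Summable fun n : ℕ => (n : ℝ) ^ 2 * degreeSize f n ^ 2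

/-! ### The scattering problem -/

/-- The radial derivative `∂_r u`. -/
def radialDeriv (u : E3 → ℂ) (x : E3) : ℂ :=
  fderiv ℝ u x (‖x‖⁻¹ • x)

/-- The spherical wave `u₀(x) = R e^{-ikR} e^{ikr} / r`, which solves the scattering problem for
the ball `B_R` with boundary value `1`. -/
def sphericalWave (k R : ℝ) (x : E3) : ℂ :=
  (R : ℂ) / Complex.exp (Complex.I * k * R) *
    (Complex.exp (Complex.I * k * (‖x‖ : ℝ)) / (‖x‖ : ℝ))

/-- The Sommerfeld radiation condition: `r (∂_r u - i k u) → 0` as `r → ∞`, uniformly in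
all directions. -/
def Radiating (k : ℝ) (u : E3 → ℂ) : Prop :=
  Tendsto (fun x : E3 => ((‖x‖ : ℝ) : ℂ) * (radialDeriv u x - Complex.I * k * u x))
    (Bornology.cobounded E3) (𝓝 0)

/-- `A` is the scattering amplitude of `u`:
`u(x) = (e^{ikr} / r) A(σ) + O(r⁻²)` as `r → ∞`, where `x = r σ`. -/
def IsScatteringAmplitude (k : ℝ) (u : E3 → ℂ) (A : S2 → ℂ) : Prop :=
  ∃ C r₀ : ℝ, 0 < r₀ ∧ ∀ r : ℝ, r₀ ≤ r → ∀ σ : S2,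
    ‖u (r • (σ : E3)) - Complex.exp (Complex.I * k * r) / r * A σ‖ ≤ C / r ^ 2

/-- `v` solves the soft obstacle problem linearized around `B_R`, with domain perturbation
`r < R + d(σ)`: the Helmholtz equation outside the closed ball, `v = - d ∂_r u₀` on the sphere of
radius `R`, and the radiation condition.  The boundary value is attained in `L²`, as it is by
`H¹` solutions (trace) and by solutions continuous up to the boundary. -/
structure IsLinearizedSoftSolution (k R : ℝ) (d : S2 → ℝ) (v : E3 → ℂ) : Prop where
  contDiffOn : ContDiffOn ℝ 2 v {x | R < ‖x‖}
  helmholtz : ∀ x : E3, R < ‖x‖ → Δ v x + (k : ℂ) ^ 2 * v x = 0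
  boundary : Tendsto
    (fun ρ : ℝ => eLpNorm
      (fun σ : S2 => v (ρ • (σ : E3)) -
        (-(d σ : ℂ) * radialDeriv (sphericalWave k R) (R • (σ : E3)))) 2 surf)
    (𝓝[>] R) (𝓝 0)
  radiation : Radiating k v

/-! ### The quantities `N`, `ε₁`, `ε₂`, `E` -/

/-- `N = [√(kR)]`. -/
def cutoff (k R : ℝ) : ℕ := ⌊Real.sqrt (k * R)⌋₊

/-- `ε₁ = (∑_{n ≤ N} aₙ²)^(1/2)`. -/
def eps1 (k R : ℝ) (A : S2 → ℂ) : ℝ :=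
  Real.sqrt (∑ n ∈ Finset.range (cutoff k R + 1), degreeSize A n ^ 2)

/-- `ε₂ = (∑_{n > N} aₙ²)^(1/2)`. -/
def eps2 (k R : ℝ) (A : S2 → ℂ) : ℝ :=
  Real.sqrt (∑' n : ℕ, degreeSize A (cutoff k R + 1 + n) ^ 2)

/-- The factor `1 / (E + k)` with `E = - log ε`; for `ε = 0` one has `E = ∞` and the factor
is `0`. -/
def invEnergy (k ε : ℝ) : ℝ :=
  if ε = 0 then 0 else 1 / (-Real.log ε + k)

end FarField

end

/-! The problem decouples over the degree of spherical harmonics. Write `ψ_n` for the Riccati–Hankel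
function. If `p` is a harmonic polynomial, homogeneous of degree `n`, then the moment of `v₀(r ·)`
against `p` on the unit sphere is a constant multiple of `ψ_n(kr)/r`. As `r → ∞` this gives the
moment of `A`; as `r → R` it gives the moment of `-d ∂_r u₀`, where `|∂_r u₀|² = k² + 1/R²`. Hence
`(k²R² + 1) aₙ(d)² = |ψ_n(kR)|² aₙ(A)²` (`mul_degreeSize_sq_eq`).

The form of the moments comes from Green's identity between `v₀` and the explicit wave `ψ_n(k|x|)
|x|^(-n-1) p(x)`: `r²` times the Wronskian of the two radial profiles is constant
(`exists_wronskian_eq`). The radiation condition and the far-field decay force this constant to be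
zero, so the quotient of the profiles is constant (`exists_sphereMoment_eq`). Completeness of the
spherical harmonics is not needed, because all norms are defined by coefficients.

The quantitative input is `1 ≤ |ψ_n(t)|² ≤ exp(n²/t)`, the upper bound for `t ≥ 1`
(`normSq_riccatiHankel_le`). It splits the degrees into three ranges. For `n ≤ N` one has `n² ≤ kR`,
and the amplification `|ψ_n(kR)|²` is at most `e`. For `n > N` with `n² < E + k` it is at most
`exp(1/R + E/2)`, since `kR ≥ 2`; the factor `ε₂² = exp(-2E)` absorbs this growth. For `n² ≥ E + k`
the `H¹` norm pays through `1 ≤ n²/(E + k)`. The three estimates differ only in how the middle range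
is treated (`tail_estimates`). -/

noncomputable section

namespace FarField

/-! ### Riccati–Hankel functions -/

/-- The outgoing Riccati–Hankel functions `t h_n⁽¹⁾(t)`, up to a constant factor of modulus one. -/
def riccatiHankel : ℕ → ℝ → ℂ
  | 0, t => Complex.exp (Complex.I * t)
  | 1, t => (1 / (t : ℂ) - Complex.I) * Complex.exp (Complex.I * t)
  | n + 2, t => (2 * n + 3) / (t : ℂ) * riccatiHankel (n + 1) t - riccatiHankel n t

theorem riccatiHankel_add_two (n : ℕ) (t : ℝ) :
    riccatiHankel (n + 2) t =
      (2 * n + 3) / (t : ℂ) * riccatiHankel (n + 1) t - riccatiHankel n t := by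
  rw [riccatiHankel]

theorem hasDerivAt_exp_I_mul (t : ℝ) :
    HasDerivAt (fun s : ℝ => Complex.exp (Complex.I * s))
      (Complex.I * Complex.exp (Complex.I * t)) t := by
  have h := ((Complex.ofRealCLM.hasDerivAt (x := t)).const_mul Complex.I).cexp
  simpa [mul_comm] using h

theorem hasDerivAt_const_div_ofReal (c : ℂ) {t : ℝ} (ht : t ≠ 0) :
    HasDerivAt (fun s : ℝ => c / (s : ℂ)) (-c / (t : ℂ) ^ 2) t := by
  have ht' : (t : ℂ) ≠ 0 := by exact_mod_cast ht
  have h := (hasDerivAt_const t c).fun_div (Complex.ofRealCLM.hasDerivAt (x := t)) (by simpa using ht')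
  simpa using h

/-- The recurrence has two steps, so the raising relation for `n` and the lowering relation for `n +
1` are carried together through the induction. -/
theorem hasDerivAt_riccatiHankel_aux (n : ℕ) {t : ℝ} (ht : t ≠ 0) :
    HasDerivAt (riccatiHankel n)
        ((n + 1) / (t : ℂ) * riccatiHankel n t - riccatiHankel (n + 1) t) t ∧
      HasDerivAt (riccatiHankel (n + 1))
        (riccatiHankel n t - (n + 1) / (t : ℂ) * riccatiHankel (n + 1) t) t := by
  have ht' : (t : ℂ) ≠ 0 := by exact_mod_cast ht
  induction n with
  | zero =>
    have h0 : HasDerivAt (riccatiHankel 0) (Complex.I * Complex.exp (Complex.I * t)) t :=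
      (hasDerivAt_exp_I_mul t).congr_of_eventuallyEq (.of_forall fun s => by rw [riccatiHankel])
    have h1 := ((hasDerivAt_const_div_ofReal 1 ht).sub_const Complex.I).mul
      (hasDerivAt_exp_I_mul t)
    have h1' : HasDerivAt (riccatiHankel 1) _ t :=
      h1.congr_of_eventuallyEq (.of_forall fun s => by rw [riccatiHankel]; rfl)
    constructor
    · convert h0 using 1
      simp only [riccatiHankel]
      push_cast
      field_simp
      ring
    · convert h1' using 1
      simp only [riccatiHankel]
      push_cast
      field_simp
      ring_nf
      simp only [Complex.I_sq]
      ring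
  | succ n ih =>
    obtain ⟨h0, h1⟩ := ih
    constructor
    · convert h1 using 1
      rw [riccatiHankel_add_two]
      push_cast
      field_simp
      ring
    · have h2 := ((hasDerivAt_const_div_ofReal (2 * n + 3) ht).mul h1).sub h0
      have h2' : HasDerivAt (riccatiHankel (n + 1 + 1)) _ t :=
        h2.congr_of_eventuallyEq (.of_forall fun s => by rw [riccatiHankel_add_two]; rfl)
      convert h2' using 1
      rw [riccatiHankel_add_two]
      push_cast
      field_simp
      ring

theorem hasDerivAt_riccatiHankel (n : ℕ) {t : ℝ} (ht : t ≠ 0) :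
    HasDerivAt (riccatiHankel n)
      ((n + 1) / (t : ℂ) * riccatiHankel n t - riccatiHankel (n + 1) t) t :=
  (hasDerivAt_riccatiHankel_aux n ht).1

theorem hasDerivAt_riccatiHankel_succ (n : ℕ) {t : ℝ} (ht : t ≠ 0) :
    HasDerivAt (riccatiHankel (n + 1))
      (riccatiHankel n t - (n + 1) / (t : ℂ) * riccatiHankel (n + 1) t) t :=
  (hasDerivAt_riccatiHankel_aux n ht).2

theorem tendsto_const_div_ofReal_atTop (c : ℂ) :
    Tendsto (fun t : ℝ => c / (t : ℂ)) atTop (𝓝 0) := by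
  have h : Tendsto (fun t : ℝ => ((t⁻¹ : ℝ) : ℂ)) atTop (𝓝 ((0 : ℝ) : ℂ)) :=
    (Complex.continuous_ofReal.tendsto 0).comp tendsto_inv_atTop_zero
  simpa [div_eq_mul_inv] using h.const_mul c

theorem tendsto_exp_neg_mul_riccatiHankel_aux (n : ℕ) :
    Tendsto (fun t : ℝ => Complex.exp (-(Complex.I * t)) * riccatiHankel n t) atTop
        (𝓝 ((-Complex.I) ^ n)) ∧
      Tendsto (fun t : ℝ => Complex.exp (-(Complex.I * t)) * riccatiHankel (n + 1) t) atTop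
        (𝓝 ((-Complex.I) ^ (n + 1))) := by
  have he (t : ℝ) : Complex.exp (-(Complex.I * t)) * Complex.exp (Complex.I * t) = 1 := by
    rw [← Complex.exp_add]; simp
  induction n with
  | zero =>
    constructor
    · simp [riccatiHankel, he]
    · have h : Tendsto (fun t : ℝ => 1 / (t : ℂ) - Complex.I) atTop (𝓝 (0 - Complex.I)) :=
        (tendsto_const_div_ofReal_atTop 1).sub_const _
      refine (h.congr fun t => ?_).trans (by simp)
      simp only [riccatiHankel]
      linear_combination (-(1 / (t : ℂ) - Complex.I)) * he t
  | succ n ih =>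
    refine ⟨ih.2, ?_⟩
    have h := ((tendsto_const_div_ofReal_atTop (2 * n + 3)).mul ih.2).sub ih.1
    have hI : (0 : ℂ) * (-Complex.I) ^ (n + 1) - (-Complex.I) ^ n = (-Complex.I) ^ (n + 1 + 1) := by
      rw [pow_succ, pow_succ]
      linear_combination (-(-Complex.I) ^ n) * Complex.I_sq
    rw [hI] at h
    refine h.congr fun t => ?_
    rw [riccatiHankel_add_two]
    ring

theorem tendsto_exp_neg_mul_riccatiHankel (n : ℕ) :
    Tendsto (fun t : ℝ => Complex.exp (-(Complex.I * t)) * riccatiHankel n t) atTop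
      (𝓝 ((-Complex.I) ^ n)) :=
  (tendsto_exp_neg_mul_riccatiHankel_aux n).1

/-! ### The modulus of the Riccati–Hankel functions -/

/-- The coefficients of `|t h_n⁽¹⁾(t)|²` as a polynomial in `t⁻²`. -/
def modulusCoeff (n j : ℕ) : ℝ :=
  ∏ i ∈ Finset.range j, ((2 * i + 1) * ((n : ℝ) - i) * (n + 1 + i) / (2 * (i + 1)))

theorem modulusCoeff_zero (n : ℕ) : modulusCoeff n 0 = 1 := by simp [modulusCoeff]

theorem modulusCoeff_succ (n j : ℕ) : modulusCoeff n (j + 1) =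
    modulusCoeff n j * ((2 * j + 1) * ((n : ℝ) - j) * (n + 1 + j) / (2 * (j + 1))) := by
  rw [modulusCoeff, Finset.prod_range_succ, modulusCoeff]

theorem modulusCoeff_self_succ (n : ℕ) : modulusCoeff n (n + 1) = 0 := by
  simp [modulusCoeff_succ]

/-- This is `|ψ_{n+1}|² = |ψ_n|² - (Re (ψ_n conj ψ_{n+1}))'` read off coefficient by coefficient in
powers of `t⁻²`. -/
theorem modulusCoeff_succ_succ (n j : ℕ) : modulusCoeff (n + 1) (j + 1) =
    modulusCoeff n (j + 1) + modulusCoeff n j * ((2 * j + 1) * (n + 1 + j)) := by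
  induction j with
  | zero => simp [modulusCoeff_succ, modulusCoeff_zero]; ring
  | succ j ih =>
    rw [modulusCoeff_succ (n + 1) (j + 1), ih, modulusCoeff_succ n (j + 1), modulusCoeff_succ n j]
    push_cast
    field_simp
    ring

theorem modulusCoeff_nonneg {n j : ℕ} (h : j ≤ n + 1) : 0 ≤ modulusCoeff n j := by
  refine Finset.prod_nonneg fun i hi => ?_
  have hi' : (i : ℝ) ≤ n := by
    exact_mod_cast Nat.lt_succ_iff.mp ((Finset.mem_range.mp hi).trans_le h)
  have : 0 ≤ (n : ℝ) - i := by linarith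
  positivity

theorem hasDerivAt_normSq_riccatiHankel (n : ℕ) {t : ℝ} (ht : t ≠ 0) :
    HasDerivAt (fun s => Complex.normSq (riccatiHankel n s))
      (2 * ((n + 1) / t * Complex.normSq (riccatiHankel n t) -
        ((riccatiHankel n t).re * (riccatiHankel (n + 1) t).re +
          (riccatiHankel n t).im * (riccatiHankel (n + 1) t).im))) t := by
  have h := hasDerivAt_riccatiHankel n ht
  have hr := Complex.reCLM.hasFDerivAt.comp_hasDerivAt t h
  have hi := Complex.imCLM.hasFDerivAt.comp_hasDerivAt t h
  have hc : ((n : ℂ) + 1) / (t : ℂ) = (((n + 1) / t : ℝ) : ℂ) := by push_cast; rfl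
  rw [hc] at hr hi
  have := (hr.fun_mul hr).fun_add (hi.fun_mul hi)
  simp only [Function.comp_def, Complex.reCLM_apply, Complex.imCLM_apply, Complex.sub_re,
    Complex.sub_im, Complex.re_ofReal_mul, Complex.im_ofReal_mul] at this
  simp only [Complex.normSq_apply]
  exact this.congr_deriv (by ring)

theorem hasDerivAt_re_mul_re_add_im_mul_im_riccatiHankel (n : ℕ) {t : ℝ} (ht : t ≠ 0) :
    HasDerivAt (fun s => (riccatiHankel n s).re * (riccatiHankel (n + 1) s).re +
        (riccatiHankel n s).im * (riccatiHankel (n + 1) s).im)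
      (Complex.normSq (riccatiHankel n t) - Complex.normSq (riccatiHankel (n + 1) t)) t := by
  have h := hasDerivAt_riccatiHankel n ht
  have h' := hasDerivAt_riccatiHankel_succ n ht
  have hr := Complex.reCLM.hasFDerivAt.comp_hasDerivAt t h
  have hi := Complex.imCLM.hasFDerivAt.comp_hasDerivAt t h
  have hr' := Complex.reCLM.hasFDerivAt.comp_hasDerivAt t h'
  have hi' := Complex.imCLM.hasFDerivAt.comp_hasDerivAt t h'
  have hc : ((n : ℂ) + 1) / (t : ℂ) = (((n + 1) / t : ℝ) : ℂ) := by push_cast; rfl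
  rw [hc] at hr hi hr' hi'
  have := (hr.fun_mul hr').fun_add (hi.fun_mul hi')
  simp only [Function.comp_def, Complex.reCLM_apply, Complex.imCLM_apply, Complex.sub_re,
    Complex.sub_im, Complex.re_ofReal_mul, Complex.im_ofReal_mul] at this
  simp only [Complex.normSq_apply]
  exact this.congr_deriv (by ring)

theorem hasDerivAt_sum_mul_zpow (N : ℕ) (a : ℕ → ℝ) (e : ℕ → ℤ) {t : ℝ} (ht : t ≠ 0) :
    HasDerivAt (fun s : ℝ => ∑ j ∈ Finset.range N, a j * s ^ e j)
      (∑ j ∈ Finset.range N, a j * (e j * t ^ (e j - 1))) t :=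
  HasDerivAt.fun_sum fun j _ => (hasDerivAt_zpow (e j) t (Or.inl ht)).const_mul (a j)

/-- Two differentiations pass from `n` to `n + 1`: the derivative of `|ψ_n|²` determines `Re (ψ_n
conj ψ_{n+1})`, whose own derivative is `|ψ_n|² - |ψ_{n+1}|²`. -/
theorem normSq_riccatiHankel (n : ℕ) : ∀ t : ℝ, 0 < t → Complex.normSq (riccatiHankel n t) =
    ∑ j ∈ Finset.range (n + 1), modulusCoeff n j * t ^ (-(2 * j : ℤ)) := by
  induction n with
  | zero =>
    intro t _
    simp [riccatiHankel, modulusCoeff_zero, Complex.normSq_eq_norm_sq, Complex.norm_exp]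
  | succ n ih =>
    have hB : ∀ t : ℝ, 0 < t → (riccatiHankel n t).re * (riccatiHankel (n + 1) t).re +
          (riccatiHankel n t).im * (riccatiHankel (n + 1) t).im =
        ∑ j ∈ Finset.range (n + 1), (modulusCoeff n j * (n + 1 + j)) * t ^ (-(2 * j : ℤ) - 1) := by
      intro t ht
      have h1 := hasDerivAt_normSq_riccatiHankel n ht.ne'
      have h2 := (hasDerivAt_sum_mul_zpow (n + 1) (modulusCoeff n)
        (fun j => -(2 * j : ℤ)) ht.ne').congr_of_eventuallyEq
        ((eventually_gt_nhds ht).mono fun s hs => ih s hs)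
      have h3 := h1.unique h2
      rw [ih t ht] at h3
      have h4 : ∑ j ∈ Finset.range (n + 1),
            (modulusCoeff n j * (n + 1 + j)) * t ^ (-(2 * j : ℤ) - 1) =
          (n + 1) / t * ∑ j ∈ Finset.range (n + 1), modulusCoeff n j * t ^ (-(2 * j : ℤ)) -
          (∑ j ∈ Finset.range (n + 1), modulusCoeff n j *
            (((-(2 * j : ℤ) : ℤ) : ℝ) * t ^ (-(2 * j : ℤ) - 1))) / 2 := by
        rw [Finset.mul_sum, Finset.sum_div, ← Finset.sum_sub_distrib]
        refine Finset.sum_congr rfl fun j _ => ?_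
        rw [zpow_sub_one₀ ht.ne']
        push_cast
        field_simp
        ring
      linarith
    intro t ht
    have h1 := hasDerivAt_re_mul_re_add_im_mul_im_riccatiHankel n ht.ne'
    have h2 := (hasDerivAt_sum_mul_zpow (n + 1) (fun j => modulusCoeff n j * (n + 1 + j))
      (fun j => -(2 * j : ℤ) - 1) ht.ne').congr_of_eventuallyEq
      ((eventually_gt_nhds ht).mono fun s hs => hB s hs)
    have h3 := h1.unique h2
    -- The shifted sum may run one index too far because `modulusCoeff n (n + 1) = 0`; its range
    -- then matches that of the differentiated sum.
    have h4 : Complex.normSq (riccatiHankel n t) = 1 + ∑ j ∈ Finset.range (n + 1),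
        modulusCoeff n (j + 1) * t ^ (-(2 * (j + 1 : ℕ) : ℤ)) := by
      rw [ih t ht, Finset.sum_range_succ' _ n, Finset.sum_range_succ _ n, modulusCoeff_self_succ]
      simp [modulusCoeff_zero, add_comm]
    have h5 : ∑ j ∈ Finset.range (n + 1 + 1), modulusCoeff (n + 1) j * t ^ (-(2 * j : ℤ)) =
        1 + ∑ j ∈ Finset.range (n + 1), modulusCoeff n (j + 1) * t ^ (-(2 * (j + 1 : ℕ) : ℤ)) -
        ∑ j ∈ Finset.range (n + 1), modulusCoeff n j * (n + 1 + j) *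
          (((-(2 * j : ℤ) - 1 : ℤ) : ℝ) * t ^ (-(2 * j : ℤ) - 1 - 1)) := by
      rw [Finset.sum_range_succ', add_sub_assoc, ← Finset.sum_sub_distrib, add_comm]
      congr 1
      · simp [modulusCoeff_zero]
      · refine Finset.sum_congr rfl fun j _ => ?_
        have : (-(2 * (j + 1 : ℕ) : ℤ)) = -(2 * j : ℤ) - 1 - 1 := by push_cast; ring
        rw [modulusCoeff_succ_succ, this]
        push_cast
        ring
    rw [h5]
    linarith

theorem one_le_normSq_riccatiHankel (n : ℕ) {t : ℝ} (ht : 0 < t) :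
    1 ≤ Complex.normSq (riccatiHankel n t) := by
  rw [normSq_riccatiHankel n t ht, Finset.sum_range_succ']
  have : 0 ≤ ∑ j ∈ Finset.range n, modulusCoeff n (j + 1) * t ^ (-(2 * (j + 1 : ℕ) : ℤ)) :=
    Finset.sum_nonneg fun j hj => mul_nonneg
      (modulusCoeff_nonneg (by have := Finset.mem_range.mp hj; omega)) (by positivity)
  simpa [modulusCoeff_zero] using this

/-- The factor `(2j)!` prepares the comparison with the power series of `cosh`. -/
theorem modulusCoeff_mul_factorial (n j : ℕ) : modulusCoeff n j * (2 * j).factorial =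
    ∏ i ∈ Finset.range j, ((2 * i + 1) ^ 2 * (((n : ℝ) - i) * (n + 1 + i))) := by
  induction j with
  | zero => simp [modulusCoeff_zero]
  | succ j ih =>
    rw [Finset.prod_range_succ, ← ih, modulusCoeff_succ,
      show 2 * (j + 1) = 2 * j + 1 + 1 by ring, Nat.factorial_succ, Nat.factorial_succ]
    push_cast
    field_simp
    ring

/-- With `s = (i + 1/2)²` and `a = (n + 1/2)²` each factor equals `4s(a - s) ≤ a²`. Replacing `n +
1/2` by `n` costs at most `e² ≤ 8` in total, and the factor `i = 0`, which is only `n(n + 1) ≤ n⁴/8`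
for `n ≥ 4`, makes up for it. The bound fails for `n = j = 1`. -/
theorem prod_range_le_pow {n j : ℕ} (hn : 2 ≤ n) (hj : j ≤ n) :
    ∏ i ∈ Finset.range j, ((2 * i + 1) ^ 2 * (((n : ℝ) - i) * (n + 1 + i))) ≤
      (n : ℝ) ^ (4 * j) := by
  rcases Nat.lt_or_ge n 4 with h4 | h4
  · interval_cases n <;> interval_cases j <;> norm_num [Finset.prod_range_succ]
  rcases j with _ | j
  · simp
  have hn0 : (4 : ℝ) ≤ n := by exact_mod_cast h4
  have hj' : (j : ℝ) + 1 ≤ n := by exact_mod_cast hj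
  have hfac : ∏ i ∈ Finset.range j, ((2 * (i + 1 : ℕ) + 1) ^ 2 *
      (((n : ℝ) - (i + 1 : ℕ)) * (n + 1 + (i + 1 : ℕ)))) ≤ ((n + 1 / 2 : ℝ) ^ 4) ^ j := by
    refine (Finset.prod_le_prod (g := fun _ => (n + 1 / 2 : ℝ) ^ 4) (fun i hi => ?_)
      fun i hi => ?_).trans (by simp)
    · have hi' : (i : ℝ) + 1 ≤ j := by exact_mod_cast Finset.mem_range.mp hi
      have : 0 ≤ (n : ℝ) - (i + 1 : ℕ) := by push_cast; linarith
      positivity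
    · push_cast
      have key : (2 * ((i : ℝ) + 1) + 1) ^ 2 * ((n - (i + 1)) * (n + 1 + (i + 1))) =
        (n + 1 / 2 : ℝ) ^ 4 -
          (2 * ((i : ℝ) + 3 / 2) ^ 2 - (n + 1 / 2 : ℝ) ^ 2) ^ 2 := by ring
      nlinarith [sq_nonneg (2 * ((i : ℝ) + 3 / 2) ^ 2 - (n + 1 / 2 : ℝ) ^ 2)]
  have hexp : ((n + 1 / 2 : ℝ) ^ 4) ^ j ≤ 8 * ((n : ℝ) ^ 4) ^ j := by
    have h1 : (n + 1 / 2 : ℝ) ≤ n * Real.exp (1 / (2 * n)) := by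
      have := Real.add_one_le_exp (1 / (2 * n : ℝ))
      calc (n + 1 / 2 : ℝ) = n * (1 / (2 * n) + 1) := by field_simp; ring
        _ ≤ _ := by gcongr
    calc ((n + 1 / 2 : ℝ) ^ 4) ^ j ≤ ((n * Real.exp (1 / (2 * n))) ^ 4) ^ j := by gcongr
      _ = Real.exp (1 / (2 * n)) ^ (4 * j) * ((n : ℝ) ^ 4) ^ j := by
        rw [mul_pow, mul_pow, pow_mul, mul_comm]
      _ ≤ 8 * ((n : ℝ) ^ 4) ^ j := by
        gcongr
        rw [← Real.exp_nat_mul]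
        calc Real.exp ((4 * j : ℕ) * (1 / (2 * n))) ≤ Real.exp 2 := by
              gcongr
              push_cast
              rw [mul_one_div, div_le_iff₀ (by positivity)]
              linarith
          _ = Real.exp 1 ^ 2 := by rw [← Real.exp_nat_mul]; norm_num
          _ ≤ 2.72 ^ 2 := by
            gcongr
            exact Real.exp_one_lt_d9.le.trans (by norm_num)
          _ ≤ 8 := by norm_num
  rw [Finset.prod_range_succ']
  calc _ ≤ 8 * ((n : ℝ) ^ 4) ^ j * ((2 * (0 : ℕ) + 1) ^ 2 *
        (((n : ℝ) - (0 : ℕ)) * (n + 1 + (0 : ℕ)))) := by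
        gcongr
        · norm_num; positivity
        · exact hfac.trans hexp
    _ = ((n : ℝ) ^ 4) ^ j * (8 * (n * (n + 1))) := by push_cast; ring
    _ ≤ ((n : ℝ) ^ 4) ^ j * (n : ℝ) ^ 4 := by
        gcongr
        nlinarith [mul_nonneg (sub_nonneg.mpr hn0) (sub_nonneg.mpr hn0),
          mul_nonneg (mul_nonneg (sub_nonneg.mpr hn0) (sub_nonneg.mpr hn0)) (sub_nonneg.mpr hn0)]
    _ = _ := by rw [← pow_succ, ← pow_mul]

theorem normSq_riccatiHankel_le (n : ℕ) {t : ℝ} (ht : 1 ≤ t) :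
    Complex.normSq (riccatiHankel n t) ≤ Real.exp ((n : ℝ) ^ 2 / t) := by
  have ht0 : 0 < t := by linarith
  rw [normSq_riccatiHankel n t ht0]
  rcases Nat.lt_or_ge n 2 with h | h
  -- For `n = 1` the modulus is `1 + t⁻² ≤ 1 + t⁻¹`, which is where `t ≥ 1` enters.
  · interval_cases n
    · simp [modulusCoeff_zero]
    · refine le_trans ?_ (Real.add_one_le_exp _)
      have : (t ^ 2)⁻¹ ≤ t⁻¹ := by
        gcongr
        nlinarith
      simp [Finset.sum_range_succ, modulusCoeff_succ, modulusCoeff_zero]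
      linarith
  · have hterm : ∀ j ∈ Finset.range (n + 1), modulusCoeff n j * t ^ (-(2 * j : ℤ)) ≤
        ((n : ℝ) ^ 2 / t) ^ (2 * j) / (2 * j).factorial := by
      intro j hj
      have hj' : j ≤ n := Nat.lt_succ_iff.mp (Finset.mem_range.mp hj)
      have h1 := prod_range_le_pow h hj'
      rw [← modulusCoeff_mul_factorial] at h1
      rw [le_div_iff₀ (by positivity), div_pow, ← pow_mul, zpow_neg, ← div_eq_mul_inv,
        div_mul_eq_mul_div]
      have : t ^ (2 * j : ℤ) = t ^ (2 * j) := by exact_mod_cast zpow_natCast t (2 * j)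
      rw [this]
      gcongr
      exact h1.trans (le_of_eq (by ring_nf))
    calc _ ≤ ∑ j ∈ Finset.range (n + 1), ((n : ℝ) ^ 2 / t) ^ (2 * j) / (2 * j).factorial :=
          Finset.sum_le_sum hterm
      _ ≤ Real.cosh ((n : ℝ) ^ 2 / t) :=
          sum_le_hasSum _ (fun j _ => by positivity) (Real.hasSum_cosh _)
      _ ≤ Real.exp ((n : ℝ) ^ 2 / t) := by
          rw [Real.cosh_eq]
          have : Real.exp (-((n : ℝ) ^ 2 / t)) ≤ Real.exp ((n : ℝ) ^ 2 / t) := by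
            gcongr
            have : 0 ≤ (n : ℝ) ^ 2 / t := by positivity
            linarith
          linarith

/-! ### Test functions -/

theorem integrable_smul_of_continuousOn {X : Type*} [TopologicalSpace X] [MeasurableSpace X]
    [OpensMeasurableSpace X] [T2Space X] {μ : Measure X} [IsFiniteMeasureOnCompacts μ]
    {U : Set X} (hU : IsOpen U)
    {η : X → ℝ} (hη : Continuous η) (hc : HasCompactSupport η) (hs : tsupport η ⊆ U)
    {W : X → ℂ} (hW : ContinuousOn W U) : Integrable (fun x => η x • W x) μ := by
  have hcont : Continuous fun x => η x • W x := by
    refine continuous_of_tsupport fun x hx => ?_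
    have hxU : x ∈ U := hs (tsupport_smul_subset_left η W hx)
    exact hη.continuousAt.smul (hW.continuousAt (hU.mem_nhds hxU))
  exact hcont.integrable_of_hasCompactSupport hc.smul_right

/-- The primitive starting at `R` vanishes to the left of the support of `η`, and to the right of it
because the total integral is zero. -/
theorem exists_contDiff_hasCompactSupport_deriv_eq {R : ℝ} {η : ℝ → ℝ} (hη : ContDiff ℝ ∞ η)
    (hc : HasCompactSupport η) (hs : tsupport η ⊆ Set.Ioi R) (h0 : ∫ x, η x = 0) :
    ∃ χ : ℝ → ℝ, ContDiff ℝ ∞ χ ∧ HasCompactSupport χ ∧ tsupport χ ⊆ Set.Ioi R ∧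
      deriv χ = η := by
  obtain ⟨a, ha, hKa⟩ : ∃ a, R < a ∧ ∀ x, x < a → η x = 0 := by
    rcases (tsupport η).eq_empty_or_nonempty with he | hne
    · exact ⟨R + 1, by linarith, fun x _ => image_eq_zero_of_notMem_tsupport (by simp [he])⟩
    · obtain ⟨a, haK, hal⟩ := IsCompact.exists_isLeast hc hne
      exact ⟨a, hs haK, fun x hx => image_eq_zero_of_notMem_tsupport
        fun hxK => absurd (hal hxK) (not_le.mpr hx)⟩
  obtain ⟨b, hKb⟩ : ∃ b, ∀ x, b < x → η x = 0 := by
    obtain ⟨b, hb⟩ := IsCompact.bddAbove hc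
    exact ⟨b, fun x hx => image_eq_zero_of_notMem_tsupport
      fun hxK => absurd (hb hxK) (not_le.mpr hx)⟩
  have hd : ∀ r, HasDerivAt (fun r => ∫ x in R..r, η x) (η r) r := fun r =>
    intervalIntegral.integral_hasDerivAt_right (hη.continuous.intervalIntegrable _ _)
      (hη.continuous.stronglyMeasurableAtFilter _ _) hη.continuous.continuousAt
  have hderiv : deriv (fun r => ∫ x in R..r, η x) = η := funext fun r => (hd r).deriv
  have hzero : ∀ r ∉ Set.Icc a b, ∫ x in R..r, η x = 0 := by
    intro r hr
    rcases lt_or_ge r a with h | h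
    · refine (intervalIntegral.integral_congr (g := fun _ => 0) fun x hx => hKa x ?_).trans
        (by simp)
      exact hx.2.trans_lt (max_lt ha h)
    · have hb : b < r := lt_of_not_ge fun h' => hr ⟨h, h'⟩
      rw [intervalIntegral.integral_eq_integral_of_support_subset, h0]
      intro x hx
      refine ⟨?_, ?_⟩
      · exact hs (subset_tsupport _ hx)
      · exact le_of_not_gt fun h' => hx (hKb x (hb.trans h'))
  have hsub : tsupport (fun r => ∫ x in R..r, η x) ⊆ Set.Icc a b :=
    closure_minimal (fun r hr => by_contra fun h => hr (hzero r h)) isClosed_Icc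
  refine ⟨fun r => ∫ x in R..r, η x, ?_, ?_, ?_, hderiv⟩
  · rw [contDiff_infty_iff_deriv, hderiv]
    exact ⟨fun r => (hd r).differentiableAt, hη⟩
  · exact IsCompact.of_isClosed_subset isCompact_Icc (isClosed_tsupport _) hsub
  · exact hsub.trans fun r hr => ha.trans_le hr.1

/-- The lemma of du Bois-Reymond on a half-line. -/
theorem exists_eq_const_of_integral_deriv_smul_eq_zero {R : ℝ} {W : ℝ → ℂ}
    (hW : ContinuousOn W (Set.Ioi R))
    (h : ∀ χ : ℝ → ℝ, ContDiff ℝ ∞ χ → HasCompactSupport χ → tsupport χ ⊆ Set.Ioi R →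
      ∫ r, deriv χ r • W r = 0) :
    ∃ c, ∀ r, R < r → W r = c := by
  let θ : ContDiffBump (R + 2) := ⟨1 / 2, 1, by norm_num, by norm_num⟩
  have hθs : tsupport (θ.normed volume) ⊆ Set.Ioi R := by
    rw [θ.tsupport_normed_eq, Real.closedBall_eq_Icc]
    intro x hx
    have := hx.1
    change _ - 1 ≤ x at this
    rw [Set.mem_Ioi]
    linarith
  have hθc : HasCompactSupport (θ.normed volume) := θ.hasCompactSupport_normed
  have hθd : ContDiff ℝ ∞ (θ.normed volume) := θ.contDiff_normed
  have hθi := integrable_smul_of_continuousOn (μ := volume) isOpen_Ioi hθd.continuous hθc hθs hW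
  set c : ℂ := ∫ r, θ.normed volume r • W r with hcdef
  have hae : ∀ᵐ r ∂volume, r ∈ Set.Ioi R → W r - c = 0 := by
    refine isOpen_Ioi.ae_eq_zero_of_integral_contDiff_smul_eq_zero
      ((hW.sub continuousOn_const).locallyIntegrableOn measurableSet_Ioi) fun φ hφd hφc hφs => ?_
    have hφi := integrable_smul_of_continuousOn (μ := volume) isOpen_Ioi hφd.continuous hφc hφs hW
    have hφ1 : Integrable φ := hφd.continuous.integrable_of_hasCompactSupport hφc
    have hθ1 : Integrable (θ.normed volume) := hθd.continuous.integrable_of_hasCompactSupport hθc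
    set α : ℝ := ∫ r, φ r with hα
    -- Subtracting `α` times the normalized bump makes the mean zero, so the difference is an
    -- admissible derivative.
    obtain ⟨χ, hχd, hχc, hχs, hχ⟩ := exists_contDiff_hasCompactSupport_deriv_eq (R := R)
      (η := φ - α • θ.normed volume) (hφd.sub (hθd.const_smul α))
      (hφc.sub (hθc.smul_left (f := fun _ => α)))
      ((tsupport_sub _ _).trans (Set.union_subset hφs
        ((tsupport_smul_subset_right (fun _ => α) _).trans hθs)))
      (by
        simp only [Pi.sub_apply, Pi.smul_apply, smul_eq_mul]
        rw [integral_sub hφ1 (hθ1.const_mul α), integral_const_mul, θ.integral_normed, mul_one,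
          hα, sub_self])
    have h0 := h χ hχd hχc hχs
    rw [hχ] at h0
    have h1 : ∫ r, (φ r • W r - α • θ.normed volume r • W r) = 0 := by
      rw [← h0]
      congr 1 with r
      simp [sub_smul, mul_assoc]
    rw [integral_sub hφi (hθi.fun_smul α), integral_smul, ← hcdef] at h1
    simp only [smul_sub]
    rw [integral_sub hφi (hφ1.smul_const c), integral_smul_const, h1]
  refine ⟨c, fun r hr => ?_⟩
  have := Measure.eqOn_open_of_ae_eq (μ := volume) (f := W) (g := fun _ => c)
    ((ae_restrict_iff' measurableSet_Ioi).mpr (hae.mono fun x hx hxR => sub_eq_zero.mp (hx hxR)))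
    isOpen_Ioi hW continuousOn_const
  exact this hr

/-! ### Polynomials as functions on `ℝ³` -/

/-- The function on `ℝ³` defined by a complex polynomial. -/
def polyFun (p : MvPolynomial (Fin 3) ℂ) (x : E3) : ℂ :=
  MvPolynomial.eval (fun i => ((x i : ℝ) : ℂ)) p

theorem hasFDerivAt_coord (i : Fin 3) (x : E3) :
    HasFDerivAt (fun y : E3 => ((y i : ℝ) : ℂ))
      (Complex.ofRealCLM.comp (EuclideanSpace.proj i : E3 →L[ℝ] ℝ)) x :=
  (Complex.ofRealCLM.comp (EuclideanSpace.proj i : E3 →L[ℝ] ℝ)).hasFDerivAt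

/-- The real linear form on `ℝ³` with the given complex coefficients. -/
def gradForm (a : Fin 3 → ℂ) : E3 →L[ℝ] ℂ :=
  ∑ i, (EuclideanSpace.proj i : E3 →L[ℝ] ℝ).smulRight (a i)

theorem gradForm_apply (a : Fin 3 → ℂ) (y : E3) : gradForm a y = ∑ i, (y i : ℂ) * a i := by
  simp [gradForm]

theorem gradForm_single (a : Fin 3 → ℂ) (i : Fin 3) :
    gradForm a (EuclideanSpace.single i 1) = a i := by
  simp [gradForm_apply, apply_ite]

theorem hasFDerivAt_polyFun (p : MvPolynomial (Fin 3) ℂ) (x : E3) :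
    HasFDerivAt (polyFun p) (gradForm fun i => polyFun (MvPolynomial.pderiv i p) x) x := by
  induction p using MvPolynomial.induction_on with
  | C a =>
    have h : HasFDerivAt (polyFun (MvPolynomial.C a)) (0 : E3 →L[ℝ] ℂ) x :=
      (hasFDerivAt_const a x).congr_of_eventuallyEq (.of_forall fun y => by simp [polyFun])
    exact h.congr_fderiv (by ext y; simp [gradForm_apply, polyFun])
  | add p q hp hq =>
    have h := hp.add hq
    have h' : HasFDerivAt (polyFun (p + q)) _ x :=
      h.congr_of_eventuallyEq (.of_forall fun y => by simp [polyFun])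
    refine h'.congr_fderiv ?_
    ext y
    simp [gradForm_apply, polyFun, mul_add, Finset.sum_add_distrib]
  | mul_X p j hp =>
    have h := hp.mul (hasFDerivAt_coord j x)
    have h' : HasFDerivAt (polyFun (p * MvPolynomial.X j)) _ x :=
      h.congr_of_eventuallyEq (.of_forall fun y => by simp [polyFun])
    refine h'.congr_fderiv ?_
    ext y
    simp [gradForm_apply, polyFun, MvPolynomial.pderiv_X, Pi.single_apply, mul_add,
      Finset.sum_add_distrib, Finset.mul_sum, apply_ite, mul_comm, mul_left_comm]

theorem continuous_polyFun (p : MvPolynomial (Fin 3) ℂ) : Continuous (polyFun p) :=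
  continuous_iff_continuousAt.mpr fun x => (hasFDerivAt_polyFun p x).continuousAt

theorem contDiff_polyFun (p : MvPolynomial (Fin 3) ℂ) {n : WithTop ℕ∞} :
    ContDiff ℝ n (polyFun p) := by
  induction p using MvPolynomial.induction_on with
  | C a =>
    have : polyFun (MvPolynomial.C a) = fun _ => a := by ext; simp [polyFun]
    rw [this]
    exact contDiff_const
  | add p q hp hq =>
    have : polyFun (p + q) = fun x => polyFun p x + polyFun q x := by ext; simp [polyFun]
    rw [this]
    exact hp.add hq
  | mul_X p j hp =>
    have : polyFun (p * MvPolynomial.X j) =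
        fun x => polyFun p x *
          (Complex.ofRealCLM.comp (EuclideanSpace.proj j : E3 →L[ℝ] ℝ)) x := by
      ext; simp [polyFun]
    rw [this]
    exact hp.mul (ContinuousLinearMap.contDiff _)

theorem polyFun_smul {p : MvPolynomial (Fin 3) ℂ} {n : ℕ} (hp : p.IsHomogeneous n) (r : ℝ)
    (x : E3) : polyFun p (r • x) = (r : ℂ) ^ n * polyFun p x := by
  simp only [polyFun, MvPolynomial.eval_eq', Finset.mul_sum]
  refine Finset.sum_congr rfl fun d hd => ?_
  have hdeg : ∑ i, d i = n := by
    have := hp (MvPolynomial.mem_support_iff.mp hd)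
    rw [← this, Finsupp.weight_apply, Finsupp.sum_fintype _ _ (by simp)]
    simp
  simp only [PiLp.smul_apply, smul_eq_mul, Complex.ofReal_mul, mul_pow, Finset.prod_mul_distrib,
    Finset.prod_pow_eq_pow_sum, hdeg]
  ring

/-! ### Separated outgoing solutions of the Helmholtz equation -/

/-- The radial factor of an outgoing wave whose angular part has degree `n`, divided by `rⁿ`. -/
def radialFactor (k : ℝ) (n : ℕ) (r : ℝ) : ℂ := riccatiHankel n (k * r) / (r : ℂ) ^ (n + 1)

/-- Dividing by `r^(n+1)` removes the zeroth-order term, so differentiation only shifts the index.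
Derivatives of outgoing waves are therefore again combinations of outgoing waves. -/
theorem hasDerivAt_radialFactor {k r : ℝ} (hk : k ≠ 0) (hr : r ≠ 0) (n : ℕ) :
    HasDerivAt (radialFactor k n) (-(k : ℂ) * r * radialFactor k (n + 1) r) r := by
  have hr' : (r : ℂ) ≠ 0 := by exact_mod_cast hr
  have hk' : (k : ℂ) ≠ 0 := by exact_mod_cast hk
  have h1 := (hasDerivAt_riccatiHankel n (mul_ne_zero hk hr)).scomp r
    ((hasDerivAt_id r).const_mul k)
  have h2 := (Complex.ofRealCLM.hasDerivAt (x := r)).fun_pow (n + 1)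
  have h3 := h1.fun_div h2 (by simpa using hr')
  refine (h3.congr_of_eventuallyEq (.of_forall fun s => ?_)).congr_deriv ?_
  · simp [radialFactor]
  · simp [radialFactor]
    field_simp
    ring

/-- The function `radialFactor k n |x| * p(x)`. -/
def outgoingWave (k : ℝ) (n : ℕ) (p : MvPolynomial (Fin 3) ℂ) (x : E3) : ℂ :=
  radialFactor k n ‖x‖ * polyFun p x

theorem hasFDerivAt_norm_of_ne {x : E3} (hx : x ≠ 0) :
    HasFDerivAt (fun y : E3 => ‖y‖) (‖x‖⁻¹ • innerSL ℝ x) x := by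
  have h := (hasStrictFDerivAt_norm_sq x).hasFDerivAt.sqrt (by simpa using hx)
  refine (h.congr_of_eventuallyEq (.of_forall fun y => ?_)).congr_fderiv ?_
  · simp
  · ext y
    simp
    ring

theorem hasFDerivAt_outgoingWave {k : ℝ} (hk : k ≠ 0) (n : ℕ) (p : MvPolynomial (Fin 3) ℂ)
    {x : E3} (hx : x ≠ 0) :
    HasFDerivAt (outgoingWave k n p) (gradForm fun i => outgoingWave k n (MvPolynomial.pderiv i p) x
      - k * outgoingWave k (n + 1) (MvPolynomial.X i * p) x) x := by
  have hx' : ‖x‖ ≠ 0 := norm_ne_zero_iff.mpr hx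
  have hx'' : (‖x‖ : ℂ) ≠ 0 := by exact_mod_cast hx'
  have h1 := (hasDerivAt_radialFactor hk hx' n).hasFDerivAt.comp x (hasFDerivAt_norm_of_ne hx)
  refine (h1.mul (hasFDerivAt_polyFun p x)).congr_fderiv ?_
  ext y
  simp [gradForm_apply, outgoingWave, polyFun, PiLp.inner_apply, Fin.sum_univ_three]
  field_simp
  ring

theorem contDiffAt_riccatiHankel (n : ℕ) {t : ℝ} (ht : t ≠ 0) {m : WithTop ℕ∞} :
    ContDiffAt ℝ m (riccatiHankel n) t ∧ ContDiffAt ℝ m (riccatiHankel (n + 1)) t := by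
  have hof : ContDiffAt ℝ m (fun s : ℝ => (s : ℂ)) t := Complex.ofRealCLM.contDiff.contDiffAt
  have ht' : (t : ℂ) ≠ 0 := by exact_mod_cast ht
  have hdiv (c : ℂ) : ContDiffAt ℝ m (fun s : ℝ => c / (s : ℂ)) t := by
    simp only [div_eq_mul_inv]
    exact contDiffAt_const.mul (hof.inv ht')
  have hexp : ContDiffAt ℝ m (fun s : ℝ => Complex.exp (Complex.I * s)) t :=
    (contDiffAt_const.mul hof).cexp
  induction n with
  | zero =>
    constructor
    · exact hexp.congr_of_eventuallyEq (.of_forall fun s => by rw [riccatiHankel])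
    · exact (((hdiv 1).sub contDiffAt_const).mul hexp).congr_of_eventuallyEq
        (.of_forall fun s => by rw [riccatiHankel])
  | succ n ih =>
    exact ⟨ih.2, (((hdiv (2 * n + 3)).mul ih.2).sub ih.1).congr_of_eventuallyEq
      (.of_forall fun s => by rw [riccatiHankel_add_two])⟩

theorem contDiffAt_outgoingWave {k : ℝ} (hk : k ≠ 0) (n : ℕ) (p : MvPolynomial (Fin 3) ℂ)
    {x : E3} (hx : x ≠ 0) {m : WithTop ℕ∞} : ContDiffAt ℝ m (outgoingWave k n p) x := by
  have hx' : ‖x‖ ≠ 0 := norm_ne_zero_iff.mpr hx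
  have hn : ContDiffAt ℝ m (fun y : E3 => ‖y‖) x := contDiffAt_norm ℝ hx
  have hof : ContDiffAt ℝ m (fun y : E3 => ((‖y‖ : ℝ) : ℂ)) x :=
    Complex.ofRealCLM.contDiff.contDiffAt.comp x hn
  have h1 : ContDiffAt ℝ m (fun y : E3 => riccatiHankel n (k * ‖y‖)) x :=
    (contDiffAt_riccatiHankel n (mul_ne_zero hk hx')).1.comp x (contDiffAt_const.mul hn)
  have h2 : ContDiffAt ℝ m (fun y : E3 => (((‖y‖ : ℝ) : ℂ) ^ (n + 1))⁻¹) x :=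
    (hof.pow (n + 1)).inv (pow_ne_zero _ (by exact_mod_cast hx'))
  exact (h1.mul h2).mul (contDiff_polyFun p).contDiffAt

/-- The second derivative of `u` in the direction of the `i`-th coordinate. -/
def secondDeriv (u : E3 → ℂ) (i : Fin 3) (x : E3) : ℂ :=
  fderiv ℝ (fderiv ℝ u) x (EuclideanSpace.single i 1) (EuclideanSpace.single i 1)

theorem laplacian_eq_sum_secondDeriv (u : E3 → ℂ) (x : E3) : Δ u x = ∑ i, secondDeriv u i x := by
  rw [InnerProductSpace.laplacian_eq_iteratedFDeriv_orthonormalBasis u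
    (EuclideanSpace.basisFun (Fin 3) ℝ)]
  simp [iteratedFDeriv_two_apply, secondDeriv]

theorem hasFDerivAt_fderiv_apply {u : E3 → ℂ} {x : E3} (hu : ContDiffAt ℝ 2 u x) (e : E3) :
    HasFDerivAt (fun y => fderiv ℝ u y e) ((fderiv ℝ (fderiv ℝ u) x).flip e) x := by
  have h : DifferentiableAt ℝ (fderiv ℝ u) x :=
    (hu.fderiv_right (m := 1) (by norm_num)).differentiableAt (by norm_num)
  exact (h.hasFDerivAt.clm_apply (hasFDerivAt_const e x)).congr_fderiv (by ext; simp)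

theorem polyFun_euler {p : MvPolynomial (Fin 3) ℂ} {n : ℕ} (hp : p.IsHomogeneous n) (x : E3) :
    ∑ i, (x i : ℂ) * polyFun (MvPolynomial.pderiv i p) x = n * polyFun p x := by
  have h := congrArg (fun q => polyFun q x) hp.sum_X_mul_pderiv
  simpa [polyFun] using h

theorem polyFun_laplacian {p : MvPolynomial (Fin 3) ℂ} {n : ℕ} (hp : p ∈ harmonicPoly n)
    (x : E3) :
    ∑ i, polyFun (MvPolynomial.pderiv i (MvPolynomial.pderiv i p)) x = 0 := by
  have h := congrArg (fun q => polyFun q x) (LinearMap.mem_ker.mp hp.2)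
  simpa [polyFun, polyLaplacian] using h

theorem secondDeriv_outgoingWave {k : ℝ} (hk : k ≠ 0) (n : ℕ) (p : MvPolynomial (Fin 3) ℂ)
    {x : E3} (hx : x ≠ 0) (i : Fin 3) : secondDeriv (outgoingWave k n p) i x =
      outgoingWave k n (MvPolynomial.pderiv i (MvPolynomial.pderiv i p)) x
      - k * outgoingWave k (n + 1) (MvPolynomial.X i * MvPolynomial.pderiv i p) x
      - k * (outgoingWave k (n + 1) (MvPolynomial.pderiv i (MvPolynomial.X i * p)) x
        - k * outgoingWave k (n + 2) (MvPolynomial.X i * (MvPolynomial.X i * p)) x) := by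
  have h1 := hasFDerivAt_fderiv_apply (contDiffAt_outgoingWave hk n p hx)
    (EuclideanSpace.single i 1)
  have h2 := (hasFDerivAt_outgoingWave hk n (MvPolynomial.pderiv i p) hx).sub
    ((hasFDerivAt_outgoingWave hk (n + 1) (MvPolynomial.X i * p) hx).const_mul (k : ℂ))
  have h3 := h1.unique (h2.congr_of_eventuallyEq ((eventually_ne_nhds hx).mono fun y hy => by
    change fderiv ℝ (outgoingWave k n p) y _ = _
    rw [(hasFDerivAt_outgoingWave hk n p hy).fderiv, gradForm_single]
    rfl))
  have h4 := congrArg (fun L : E3 →L[ℝ] ℂ => L (EuclideanSpace.single i 1)) h3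
  simpa [gradForm_single, secondDeriv] using h4

/-- Four facts combine linearly: harmonicity of `p`, Euler's identity, `∑ xᵢ² = |x|²`, and the
three-term recurrence. -/
theorem helmholtz_outgoingWave {k : ℝ} (hk : k ≠ 0) {n : ℕ} {p : MvPolynomial (Fin 3) ℂ}
    (hp : p ∈ harmonicPoly n) {x : E3} (hx : x ≠ 0) :
    Δ (outgoingWave k n p) x + (k : ℂ) ^ 2 * outgoingWave k n p x = 0 := by
  have hx' : ‖x‖ ≠ 0 := norm_ne_zero_iff.mpr hx
  have hxc : (‖x‖ : ℂ) ≠ 0 := by exact_mod_cast hx'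
  have hkc : (k : ℂ) ≠ 0 := by exact_mod_cast hk
  have hE := polyFun_euler hp.1 x
  have hL := polyFun_laplacian hp x
  have hN : (x 0 : ℂ) ^ 2 + (x 1 : ℂ) ^ 2 + (x 2 : ℂ) ^ 2 = (‖x‖ : ℂ) ^ 2 := by
    have := EuclideanSpace.real_norm_sq_eq x
    rw [Fin.sum_univ_three] at this
    exact_mod_cast this.symm
  have hrec : (k : ℂ) ^ 2 * (‖x‖ : ℂ) ^ 2 * radialFactor k (n + 2) ‖x‖ =
      k * (2 * n + 3) * radialFactor k (n + 1) ‖x‖ - k ^ 2 * radialFactor k n ‖x‖ := by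
    simp only [radialFactor, riccatiHankel_add_two]
    push_cast
    field_simp
    ring
  rw [laplacian_eq_sum_secondDeriv]
  simp only [secondDeriv_outgoingWave hk n p hx, Fin.sum_univ_three] at hE hL ⊢
  simp only [outgoingWave, polyFun, Derivation.leibniz, map_mul, map_add, MvPolynomial.eval_X,
    MvPolynomial.pderiv_X_self, smul_eq_mul, mul_one] at hE hL ⊢
  linear_combination radialFactor k n ‖x‖ * hL - 2 * k * radialFactor k (n + 1) ‖x‖ * hE
    + k ^ 2 * radialFactor k (n + 2) ‖x‖ * MvPolynomial.eval (fun i => ((x i : ℝ) : ℂ)) p * hN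
    + MvPolynomial.eval (fun i => ((x i : ℝ) : ℂ)) p * hrec

/-! ### Green's identity against radial test functions -/

theorem isOpen_lt_norm (R : ℝ) : IsOpen {x : E3 | R < ‖x‖} :=
  isOpen_lt continuous_const continuous_norm

theorem clm_eq_sum (L : E3 →L[ℝ] ℂ) (y : E3) :
    L y = ∑ i, y i • L (EuclideanSpace.single i 1) := by
  conv_lhs => rw [← (EuclideanSpace.basisFun (Fin 3) ℝ).sum_repr y]
  simp

theorem tsupport_comp_norm_subset {R : ℝ} {χ : ℝ → ℝ} (hs : tsupport χ ⊆ Set.Ioi R) :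
    tsupport (fun x : E3 => χ ‖x‖) ⊆ {x : E3 | R < ‖x‖} := fun _ hx =>
  hs (tsupport_comp_subset_preimage χ continuous_norm hx)

theorem hasCompactSupport_comp_norm {χ : ℝ → ℝ} (hc : HasCompactSupport χ) :
    HasCompactSupport (fun x : E3 => χ ‖x‖) := by
  obtain ⟨M, hM⟩ := IsCompact.bddAbove hc
  refine HasCompactSupport.of_support_subset_isCompact (isCompact_closedBall (0 : E3) M)
    fun x hx => ?_
  rw [mem_closedBall_zero_iff]
  exact hM (subset_tsupport _ hx)

theorem hasLineDerivAt_comp_norm {R : ℝ} (hR : 0 ≤ R) {χ : ℝ → ℝ} (hχ : Differentiable ℝ χ)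
    (hs : tsupport χ ⊆ Set.Ioi R) (x : E3) (i : Fin 3) :
    HasLineDerivAt ℝ (fun x : E3 => χ ‖x‖) (deriv χ ‖x‖ * (‖x‖⁻¹ * x i)) x
      (EuclideanSpace.single i 1) := by
  rcases eq_or_ne x 0 with rfl | hx
  -- The norm is not differentiable at the origin, but the composite vanishes near it since `R ≥ 0`.
  · have h0 : (0 : E3) ∉ tsupport (fun x : E3 => χ ‖x‖) := fun h => by
      have := tsupport_comp_norm_subset hs h
      simp only [Set.mem_ofPred_eq, norm_zero] at this
      linarith
    have h := (hasFDerivAt_const (𝕜 := ℝ) (0 : ℝ) (0 : E3)).congr_of_eventuallyEq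
      (notMem_tsupport_iff_eventuallyEq.mp h0)
    simpa using h.hasLineDerivAt (EuclideanSpace.single i 1)
  · have h := ((hχ ‖x‖).hasDerivAt.comp_hasFDerivAt x (hasFDerivAt_norm_of_ne hx)).hasLineDerivAt
      (EuclideanSpace.single i 1)
    simpa [Function.comp_def, EuclideanSpace.inner_single_right] using h

/-- The field `v ∇u - u ∇v` is divergence free, so testing it against the gradient of `χ(|x|)` gives
zero. This says weakly that its flux through the sphere of radius `r` does not depend on `r`, and it
needs only integration by parts on all of space, one coordinate at a time. -/
theorem integral_deriv_comp_norm_smul_wronskian {R : ℝ} (hR : 0 ≤ R) {u v : E3 → ℂ}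
    (hu : ContDiffOn ℝ 2 u {x | R < ‖x‖}) (hv : ContDiffOn ℝ 2 v {x | R < ‖x‖})
    (hΔ : ∀ x, R < ‖x‖ → v x * Δ u x - u x * Δ v x = 0)
    {χ : ℝ → ℝ} (hχ : ContDiff ℝ ∞ χ) (hc : HasCompactSupport χ) (hs : tsupport χ ⊆ Set.Ioi R) :
    ∫ x : E3, deriv χ ‖x‖ • (v x * radialDeriv u x - u x * radialDeriv v x) = 0 := by
  set U : Set E3 := {x | R < ‖x‖} with hU
  have hUo : IsOpen U := isOpen_lt_norm R
  have hcd {w : E3 → ℂ} (hw : ContDiffOn ℝ 2 w U) {x : E3} (hx : x ∈ U) : ContDiffAt ℝ 2 w x :=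
    hw.contDiffAt (hUo.mem_nhds hx)
  have hD1 {w : E3 → ℂ} (hw : ContDiffOn ℝ 2 w U) : ContinuousOn (fderiv ℝ w) U :=
    hw.continuousOn_fderiv_of_isOpen hUo (by norm_num)
  have hD2 {w : E3 → ℂ} (hw : ContDiffOn ℝ 2 w U) (i : Fin 3) :
      ContinuousOn (secondDeriv w i) U :=
    (((hw.fderiv_of_isOpen hUo (m := 1) (by norm_num)).continuousOn_fderiv_of_isOpen hUo
      (by norm_num)).clm_apply continuousOn_const).clm_apply continuousOn_const
  let e : Fin 3 → E3 := fun i => EuclideanSpace.single i 1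
  let g : Fin 3 → E3 → ℂ := fun i x => v x * fderiv ℝ u x (e i) - u x * fderiv ℝ v x (e i)
  let g' : Fin 3 → E3 → ℂ := fun i x => v x * secondDeriv u i x - u x * secondDeriv v i x
  have hgc (i) : ContinuousOn (g i) U :=
    (hv.continuousOn.mul ((hD1 hu).clm_apply continuousOn_const)).sub
      (hu.continuousOn.mul ((hD1 hv).clm_apply continuousOn_const))
  have hgc' (i) : ContinuousOn (g' i) U :=
    (hv.continuousOn.mul (hD2 hu i)).sub (hu.continuousOn.mul (hD2 hv i))
  have hinv (i : Fin 3) : ContinuousOn (fun x : E3 => ‖x‖⁻¹ * x i) U :=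
    (continuous_norm.continuousOn.inv₀ fun x hx => (hR.trans_lt hx).ne').mul (by fun_prop)
  have hχd : ContDiff ℝ ∞ (deriv χ) := (contDiff_infty_iff_deriv.mp hχ).2
  have hcd' : HasCompactSupport (deriv χ) := hc.deriv
  have hsd : tsupport (deriv χ) ⊆ Set.Ioi R :=
    (closure_minimal (support_deriv_subset) (isClosed_tsupport χ)).trans hs
  have hi1 (i) : Integrable (fun x : E3 => χ ‖x‖ • g i x) :=
    integrable_smul_of_continuousOn hUo (hχ.continuous.comp continuous_norm)
      (hasCompactSupport_comp_norm hc) (tsupport_comp_norm_subset hs) (hgc i)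
  have hi2 (i) : Integrable (fun x : E3 => χ ‖x‖ • g' i x) :=
    integrable_smul_of_continuousOn hUo (hχ.continuous.comp continuous_norm)
      (hasCompactSupport_comp_norm hc) (tsupport_comp_norm_subset hs) (hgc' i)
  have hi3 (i) : Integrable (fun x : E3 => (deriv χ ‖x‖ * (‖x‖⁻¹ * x i)) • g i x) := by
    simp only [mul_smul]
    simp only [← mul_smul ‖_‖⁻¹]
    exact integrable_smul_of_continuousOn hUo (hχd.continuous.comp continuous_norm)
      (hasCompactSupport_comp_norm hcd') (tsupport_comp_norm_subset hsd) ((hinv i).smul (hgc i))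
  have hparts (i) : ∫ x : E3, χ ‖x‖ • g' i x =
      - ∫ x : E3, (deriv χ ‖x‖ * (‖x‖⁻¹ * x i)) • g i x := by
    refine integral_bilinear_hasLineDerivAt_right_eq_neg_left_of_integrable
      (B := ContinuousLinearMap.lsmul ℝ ℝ) (v := e i) (hi3 i) (hi2 i) (hi1 i)
      (fun x _ => hasLineDerivAt_comp_norm hR (hχ.differentiable (by norm_num)) hs x i)
      fun x hx => ?_
    have hxU : x ∈ U := tsupport_comp_norm_subset hs hx
    have hu1 := ((hcd hu hxU).differentiableAt (by norm_num)).hasFDerivAt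
    have hv1 := ((hcd hv hxU).differentiableAt (by norm_num)).hasFDerivAt
    have h := ((hv1.mul (hasFDerivAt_fderiv_apply (hcd hu hxU) (e i))).sub
      (hu1.mul (hasFDerivAt_fderiv_apply (hcd hv hxU) (e i)))).hasLineDerivAt (e i)
    convert! h using 1
    simp [g', secondDeriv, e]
    ring
  have hsum : ∑ i, ∫ x : E3, (deriv χ ‖x‖ * (‖x‖⁻¹ * x i)) • g i x =
      ∫ x : E3, deriv χ ‖x‖ • (v x * radialDeriv u x - u x * radialDeriv v x) := by
    rw [← integral_finsetSum _ fun i _ => hi3 i]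
    congr 1 with x
    simp only [radialDeriv, clm_eq_sum _ (‖x‖⁻¹ • x), Fin.sum_univ_three, g, e]
    simp
    ring
  have hzero : ∑ i, ∫ x : E3, χ ‖x‖ • g' i x = 0 := by
    rw [← integral_finsetSum _ fun i _ => hi2 i]
    refine (integral_congr_ae (.of_forall fun x => ?_)).trans (integral_zero _ _)
    by_cases hx : R < ‖x‖
    · have := hΔ x hx
      rw [laplacian_eq_sum_secondDeriv, laplacian_eq_sum_secondDeriv, Finset.mul_sum,
        Finset.mul_sum, ← Finset.sum_sub_distrib] at this
      simp only [g', ← Finset.smul_sum, this, smul_zero]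
    · have : χ ‖x‖ = 0 := image_eq_zero_of_notMem_tsupport fun h => hx (hs h)
      simp [this]
  rw [← hsum]
  simp only [hparts, Finset.sum_neg_distrib, neg_eq_zero] at hzero
  exact hzero

/-- Polar coordinates turn the weak Green identity into a statement about functions of `r`. -/
theorem integral_eq_integral_sphere {F : E3 → ℂ} (hF : Integrable F) :
    ∫ x, F x = ∫ r in Set.Ioi (0 : ℝ), r ^ 2 • ∫ σ : S2, F (r • (σ : E3)) ∂surf := by
  have hmp := (volume : Measure E3).measurePreserving_homeomorphUnitSphereProd
  have hemb := (homeomorphUnitSphereProd E3).measurableEmbedding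
  have hdim : Module.finrank ℝ E3 - 1 = 2 := by simp
  have hF' : Integrable (fun z : S2 × Set.Ioi (0 : ℝ) => F ((z.2 : ℝ) • (z.1 : E3)))
      (surf.prod (Measure.volumeIoiPow (Module.finrank ℝ E3 - 1))) := by
    rw [← hmp.integrable_comp_emb hemb]
    have h1 := (integrableOn_iff_comap_subtypeVal (measurableSet_singleton (0 : E3)).compl).mp
      hF.integrableOn
    refine h1.congr (.of_forall fun x => ?_)
    have hx : ‖(x : E3)‖ ≠ 0 := norm_ne_zero_iff.mpr x.2
    simp [smul_smul, hx]
  calc ∫ x, F x = ∫ x : ({(0 : E3)}ᶜ : Set E3), F (x : E3) ∂((volume : Measure E3).comap (↑)) := by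
        rw [integral_subtype_comap (measurableSet_singleton _).compl F, restrict_compl_singleton]
    _ = ∫ z : S2 × Set.Ioi (0 : ℝ), F ((z.2 : ℝ) • (z.1 : E3))
          ∂(surf.prod (Measure.volumeIoiPow (Module.finrank ℝ E3 - 1))) := by
        rw [← hmp.integral_comp hemb]
        congr 1 with x
        have hx : ‖(x : E3)‖ ≠ 0 := norm_ne_zero_iff.mpr x.2
        simp [smul_smul, hx]
    _ = ∫ r : Set.Ioi (0 : ℝ), (∫ σ : S2, F ((r : ℝ) • (σ : E3)) ∂surf)
          ∂(Measure.volumeIoiPow (Module.finrank ℝ E3 - 1)) := integral_prod_symm _ hF'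
    _ = _ := by
        rw [hdim]
        simp only [Measure.volumeIoiPow, ENNReal.ofReal]
        rw [integral_withDensity_eq_integral_smul,
          integral_subtype_comap measurableSet_Ioi
            fun r : ℝ => Real.toNNReal (r ^ 2) • ∫ σ : S2, F (r • (σ : E3)) ∂surf,
          setIntegral_congr_fun measurableSet_Ioi fun r hr => ?_]
        · rw [NNReal.smul_def, Real.coe_toNNReal _ (sq_nonneg r)]
        · exact (measurable_subtype_coe.pow_const _).real_toNNReal

/-! ### Moments of a function on concentric spheres -/

/-- The moment of `w(r ·)` against a polynomial on the unit sphere. -/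
def sphereMoment (w : E3 → ℂ) (p : MvPolynomial (Fin 3) ℂ) (r : ℝ) : ℂ :=
  ∫ σ : S2, w (r • (σ : E3)) * polyFun p σ ∂surf

theorem norm_smul_sphere {r : ℝ} (hr : 0 ≤ r) (σ : S2) : ‖r • (σ : E3)‖ = r := by
  simp [norm_smul, abs_of_nonneg hr]

theorem continuous_polyFun_sphere (p : MvPolynomial (Fin 3) ℂ) :
    Continuous fun σ : S2 => polyFun p σ := (continuous_polyFun p).comp continuous_subtype_val

theorem integrable_of_continuous_sphere {g : S2 → ℂ} (hg : Continuous g) : Integrable g surf :=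
  hg.integrable_of_hasCompactSupport (HasCompactSupport.of_compactSpace g)

theorem norm_integral_mul_polyFun_le (p : MvPolynomial (Fin 3) ℂ) {g : S2 → ℂ} {C : ℝ}
    (hg : ∀ σ, ‖g σ‖ ≤ C) :
    ‖∫ σ : S2, g σ * polyFun p σ ∂surf‖ ≤ C * ∫ σ : S2, ‖polyFun p σ‖ ∂surf := by
  rw [← integral_const_mul]
  refine norm_integral_le_of_norm_le
    ((integrable_of_continuous_sphere (continuous_polyFun_sphere p)).norm.const_mul C)
    (.of_forall fun σ => ?_)
  rw [norm_mul]
  gcongr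
  exact hg σ

theorem continuous_comp_smul_sphere {R r : ℝ} (hR : 0 ≤ R) (hr : R < r) {w : E3 → ℂ}
    (hw : ContinuousOn w {x | R < ‖x‖}) : Continuous fun σ : S2 => w (r • (σ : E3)) := by
  refine hw.comp_continuous (by fun_prop) fun σ => ?_
  change R < ‖r • (σ : E3)‖
  rwa [norm_smul_sphere (hR.trans hr.le)]

theorem integrable_moment {R r : ℝ} (hR : 0 ≤ R) (hr : R < r) {w : E3 → ℂ}
    (hw : ContinuousOn w {x | R < ‖x‖}) (p : MvPolynomial (Fin 3) ℂ) :
    Integrable (fun σ : S2 => w (r • (σ : E3)) * polyFun p σ) surf :=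
  integrable_of_continuous_sphere
    ((continuous_comp_smul_sphere hR hr hw).mul (continuous_polyFun_sphere p))

theorem exists_bound_comp_smul_sphere {R a : ℝ} (hR : 0 ≤ R) (ha : R < a) (b : ℝ) {w : E3 → ℂ}
    (hw : ContinuousOn w {x | R < ‖x‖}) :
    ∃ C, ∀ r ∈ Set.Icc a b, ∀ σ : S2, ‖w (r • (σ : E3))‖ ≤ C := by
  have hK : IsCompact ((fun z : ℝ × S2 => z.1 • (z.2 : E3)) '' (Set.Icc a b ×ˢ Set.univ)) :=
    (isCompact_Icc.prod isCompact_univ).image (by fun_prop)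
  obtain ⟨C, hC⟩ := hK.exists_bound_of_continuousOn (f := w) (hw.mono (by
    rintro _ ⟨⟨r, σ⟩, ⟨hr, -⟩, rfl⟩
    change R < ‖r • (σ : E3)‖
    have hr1 : a ≤ r := hr.1
    rw [norm_smul_sphere (by linarith)]
    linarith))
  exact ⟨C, fun r hr σ => hC _ ⟨(r, σ), ⟨hr, Set.mem_univ _⟩, rfl⟩⟩

theorem continuousOn_sphereMoment {R : ℝ} (hR : 0 ≤ R) {w : E3 → ℂ}
    (hw : ContinuousOn w {x | R < ‖x‖}) (p : MvPolynomial (Fin 3) ℂ) :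
    ContinuousOn (sphereMoment w p) (Set.Ioi R) := by
  intro r hr
  refine ContinuousAt.continuousWithinAt ?_
  obtain ⟨a, ha, har⟩ := exists_between (Set.mem_Ioi.mp hr)
  obtain ⟨C, hC⟩ := exists_bound_comp_smul_sphere hR ha (r + 1) hw
  refine continuousAt_of_dominated (bound := fun σ => C * ‖polyFun p σ‖) ?_ ?_ ?_ ?_
  · filter_upwards [eventually_gt_nhds har] with s hs
    exact (integrable_moment hR (ha.trans hs) hw p).aestronglyMeasurable
  · filter_upwards [eventually_gt_nhds har, eventually_lt_nhds (lt_add_one r)] with s hs hs'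
    refine .of_forall fun σ => ?_
    rw [norm_mul]
    gcongr
    exact hC s ⟨hs.le, hs'.le⟩ σ
  · exact (integrable_of_continuous_sphere (continuous_polyFun_sphere p)).norm.const_mul C
  · refine .of_forall fun σ => ContinuousAt.mul ?_ continuousAt_const
    have hx : R < ‖r • (σ : E3)‖ := by
      rwa [norm_smul_sphere (hR.trans (le_of_lt hr))]
    exact (hw.continuousAt ((isOpen_lt_norm R).mem_nhds hx)).comp
      (f := fun s : ℝ => s • (σ : E3)) (by fun_prop)

theorem radialDeriv_smul_sphere {r : ℝ} (hr : 0 < r) (w : E3 → ℂ) (σ : S2) :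
    radialDeriv w (r • (σ : E3)) = fderiv ℝ w (r • (σ : E3)) σ := by
  rw [radialDeriv, norm_smul_sphere hr.le, smul_smul, inv_mul_cancel₀ hr.ne', one_smul]

theorem hasDerivAt_comp_smul_sphere {r : ℝ} (hr : 0 < r) {w : E3 → ℂ} {σ : S2}
    (hw : DifferentiableAt ℝ w (r • (σ : E3))) :
    HasDerivAt (fun s : ℝ => w (s • (σ : E3))) (radialDeriv w (r • (σ : E3))) r := by
  rw [radialDeriv_smul_sphere hr]
  have h := (hasDerivAt_id r).smul_const (σ : E3)
  simpa [Function.comp_def] using hw.hasFDerivAt.comp_hasDerivAt r h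

theorem continuousOn_radialDeriv {R : ℝ} (hR : 0 ≤ R) {w : E3 → ℂ}
    (hw : ContDiffOn ℝ 2 w {x | R < ‖x‖}) : ContinuousOn (radialDeriv w) {x | R < ‖x‖} :=
  (hw.continuousOn_fderiv_of_isOpen (isOpen_lt_norm R) (by norm_num)).clm_apply
    ((continuous_norm.continuousOn.inv₀ fun _ hx => (hR.trans_lt hx).ne').smul continuousOn_id)

theorem hasDerivAt_sphereMoment {R r : ℝ} (hR : 0 ≤ R) (hr : R < r) {w : E3 → ℂ}
    (hw : ContDiffOn ℝ 2 w {x | R < ‖x‖}) (p : MvPolynomial (Fin 3) ℂ) :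
    HasDerivAt (sphereMoment w p) (sphereMoment (radialDeriv w) p r) r := by
  obtain ⟨a, ha, har⟩ := exists_between hr
  have hd := continuousOn_radialDeriv hR hw
  obtain ⟨C, hC⟩ := exists_bound_comp_smul_sphere hR ha (r + 1) hd
  refine (hasDerivAt_integral_of_dominated_loc_of_deriv_le
    (bound := fun σ : S2 => C * ‖polyFun p σ‖)
    (F' := fun s σ => radialDeriv w (s • (σ : E3)) * polyFun p σ)
    (Icc_mem_nhds har (lt_add_one r)) ?_
    (integrable_moment hR hr hw.continuousOn p)
    (integrable_moment hR hr hd p).aestronglyMeasurable ?_ ?_ ?_).2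
  · filter_upwards [eventually_gt_nhds hr] with s hs
    exact (integrable_moment hR hs hw.continuousOn p).aestronglyMeasurable
  · refine .of_forall fun σ s hs => ?_
    rw [norm_mul]
    gcongr
    exact hC s hs σ
  · exact (integrable_of_continuous_sphere (continuous_polyFun_sphere p)).norm.const_mul C
  · refine .of_forall fun σ s hs => HasDerivAt.mul_const ?_ _
    have hs1 : a ≤ s := hs.1
    have hs0 : 0 < s := by linarith
    refine hasDerivAt_comp_smul_sphere hs0 ((hw.contDiffAt ((isOpen_lt_norm R).mem_nhds ?_))
      |>.differentiableAt (by norm_num))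
    change R < ‖s • (σ : E3)‖
    rw [norm_smul_sphere hs0.le]
    linarith

/-- The radial profile `ψ_n(kr) / r` of an outgoing wave of degree `n`. -/
def radialProfile (k : ℝ) (n : ℕ) (r : ℝ) : ℂ := riccatiHankel n (k * r) / r

/-- The derivative of `radialProfile`. -/
def radialProfileDeriv (k : ℝ) (n : ℕ) (r : ℝ) : ℂ :=
  (n / (r : ℂ) * riccatiHankel n (k * r) - k * riccatiHankel (n + 1) (k * r)) / r

theorem hasDerivAt_radialProfile {k r : ℝ} (hk : k ≠ 0) (hr : r ≠ 0) (n : ℕ) :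
    HasDerivAt (radialProfile k n) (radialProfileDeriv k n r) r := by
  have hr' : (r : ℂ) ≠ 0 := by exact_mod_cast hr
  have hk' : (k : ℂ) ≠ 0 := by exact_mod_cast hk
  have h1 := (hasDerivAt_riccatiHankel n (mul_ne_zero hk hr)).scomp r
    ((hasDerivAt_id r).const_mul k)
  have h3 := h1.fun_div (Complex.ofRealCLM.hasDerivAt (x := r)) (by simpa using hr')
  refine (h3.congr_of_eventuallyEq (.of_forall fun s => ?_)).congr_deriv ?_
  · simp [radialProfile]
  · simp [radialProfileDeriv]
    field_simp
    ring

theorem radialProfile_ne_zero {k r : ℝ} (hk : 0 < k) (hr : 0 < r) (n : ℕ) :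
    radialProfile k n r ≠ 0 := by
  have h := one_le_normSq_riccatiHankel n (mul_pos hk hr)
  refine div_ne_zero (fun h0 => ?_) (by exact_mod_cast hr.ne')
  rw [h0] at h
  simp at h
  linarith

theorem outgoingWave_smul_sphere {k r : ℝ} (hr : 0 < r) {n : ℕ} {p : MvPolynomial (Fin 3) ℂ}
    (hp : p.IsHomogeneous n) (σ : S2) :
    outgoingWave k n p (r • (σ : E3)) = radialProfile k n r * polyFun p σ := by
  have hr' : (r : ℂ) ≠ 0 := by exact_mod_cast hr.ne'
  rw [outgoingWave, norm_smul_sphere hr.le, polyFun_smul hp, radialFactor, radialProfile]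
  field_simp
  ring

theorem radialDeriv_outgoingWave_smul_sphere {k r : ℝ} (hk : k ≠ 0) (hr : 0 < r) {n : ℕ}
    {p : MvPolynomial (Fin 3) ℂ} (hp : p.IsHomogeneous n) (σ : S2) :
    radialDeriv (outgoingWave k n p) (r • (σ : E3)) =
      radialProfileDeriv k n r * polyFun p σ := by
  have hx : r • (σ : E3) ≠ 0 := by
    rw [← norm_ne_zero_iff, norm_smul_sphere hr.le]
    exact hr.ne'
  have h1 := hasDerivAt_comp_smul_sphere hr
    (hasFDerivAt_outgoingWave hk n p hx).differentiableAt
  have h2 := (hasDerivAt_radialProfile hk hr.ne' n).mul_const (polyFun p σ)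
  exact h1.unique (h2.congr_of_eventuallyEq ((eventually_gt_nhds hr).mono fun s hs =>
    outgoingWave_smul_sphere hs hp σ))

/-- The Wronskian of the moment of a solution and the radial profile of degree `n` is constant. -/
theorem exists_wronskian_eq {k R : ℝ} (hk : k ≠ 0) (hR : 0 ≤ R) {v : E3 → ℂ}
    (hv : ContDiffOn ℝ 2 v {x | R < ‖x‖})
    (hvH : ∀ x, R < ‖x‖ → Δ v x + (k : ℂ) ^ 2 * v x = 0)
    {n : ℕ} {p : MvPolynomial (Fin 3) ℂ} (hp : p ∈ harmonicPoly n) :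
    ∃ c : ℂ, ∀ r, R < r → (r : ℂ) ^ 2 * (radialProfileDeriv k n r * sphereMoment v p r -
      radialProfile k n r * sphereMoment (radialDeriv v) p r) = c := by
  have hne {x : E3} (hx : R < ‖x‖) : x ≠ 0 := norm_pos_iff.mp (hR.trans_lt hx)
  have hdv := continuousOn_radialDeriv hR hv
  have hprofile : ContinuousOn (radialProfile k n) (Set.Ioi R) := fun r hr =>
    (hasDerivAt_radialProfile hk (hR.trans_lt hr).ne' n).continuousAt.continuousWithinAt
  have hprofile' : ContinuousOn (radialProfileDeriv k n) (Set.Ioi R) := fun r hr => by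
    have hr0 : r ≠ 0 := (hR.trans_lt hr).ne'
    have hr0' : (r : ℂ) ≠ 0 := by exact_mod_cast hr0
    have hψ (m) : ContinuousAt (fun s => riccatiHankel m (k * s)) r :=
      (hasDerivAt_riccatiHankel m (mul_ne_zero hk hr0)).continuousAt.comp
        (f := fun s => k * s) (by fun_prop)
    have hof : ContinuousAt (fun s : ℝ => (s : ℂ)) r := Complex.continuous_ofReal.continuousAt
    exact ((((continuousAt_const.div hof hr0').mul (hψ n)).sub
      (continuousAt_const.mul (hψ (n + 1)))).div hof hr0').continuousWithinAt
  -- By du Bois-Reymond it is enough that the continuous candidate has vanishing weak derivative,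
  -- which is Green's identity in polar coordinates.
  refine exists_eq_const_of_integral_deriv_smul_eq_zero ?_ fun χ hχ hc hs => ?_
  · exact (by fun_prop : ContinuousOn (fun r : ℝ => (r : ℂ) ^ 2) (Set.Ioi R)).mul
      ((hprofile'.mul (continuousOn_sphereMoment hR hv.continuousOn p)).sub
        (hprofile.mul (continuousOn_sphereMoment hR hdv p)))
  have hu : ContDiffOn ℝ 2 (outgoingWave k n p) {x | R < ‖x‖} := fun x hx =>
    (contDiffAt_outgoingWave hk n p (hne hx)).contDiffWithinAt
  have hgreen := integral_deriv_comp_norm_smul_wronskian hR hu hv (fun x hx => by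
    linear_combination v x * helmholtz_outgoingWave hk hp (hne hx) -
      outgoingWave k n p x * hvH x hx) hχ hc hs
  have hsd : tsupport (deriv χ) ⊆ Set.Ioi R :=
    (closure_minimal (support_deriv_subset) (isClosed_tsupport χ)).trans hs
  have hint := integrable_smul_of_continuousOn (μ := (volume : Measure E3)) (isOpen_lt_norm R)
    ((contDiff_infty_iff_deriv.mp hχ).2.continuous.comp continuous_norm)
    (hasCompactSupport_comp_norm hc.deriv) (tsupport_comp_norm_subset hsd)
    ((hv.continuousOn.mul (continuousOn_radialDeriv hR hu)).sub (hu.continuousOn.mul hdv))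
  have hpolar := (integral_eq_integral_sphere hint).symm.trans hgreen
  rw [← hpolar]
  have hsupp : Function.support (fun r : ℝ => deriv χ r • ((r : ℂ) ^ 2 *
      (radialProfileDeriv k n r * sphereMoment v p r -
        radialProfile k n r * sphereMoment (radialDeriv v) p r))) ⊆ Set.Ioi 0 := fun r hr => by
    refine hR.trans_lt (hsd (subset_tsupport _ fun h0 => hr ?_))
    simp [h0]
  rw [← setIntegral_eq_integral_of_forall_compl_eq_zero (s := Set.Ioi (0 : ℝ))
    fun r hr => Function.notMem_support.mp fun h => hr (hsupp h)]
  refine setIntegral_congr_fun measurableSet_Ioi fun r hr => ?_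
  have hr0 : 0 < r := hr
  simp only [Function.comp_apply, norm_smul_sphere hr0.le, Pi.mul_apply, Pi.sub_apply]
  by_cases hrR : R < r
  · have h1 := integrable_moment hR hrR hv.continuousOn p
    have h2 := integrable_moment hR hrR hdv p
    have : ∫ σ : S2, deriv χ r • (v (r • (σ : E3)) *
        radialDeriv (outgoingWave k n p) (r • (σ : E3)) -
        outgoingWave k n p (r • (σ : E3)) * radialDeriv v (r • (σ : E3))) ∂surf =
      deriv χ r • (radialProfileDeriv k n r * sphereMoment v p r -
        radialProfile k n r * sphereMoment (radialDeriv v) p r) := by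
      rw [integral_smul, sphereMoment, sphereMoment, ← integral_const_mul, ← integral_const_mul,
        ← integral_sub (h1.const_mul _) (h2.const_mul _)]
      congr 2 with σ
      rw [radialDeriv_outgoingWave_smul_sphere hk hr0 hp.1, outgoingWave_smul_sphere hr0 hp.1]
      ring
    rw [this]
    simp
    ring
  · have : deriv χ r = 0 := image_eq_zero_of_notMem_tsupport fun h => hrR (hsd h)
    simp [this]

/-! ### Identification of the moments of a radiating solution -/

theorem tendsto_radiation_moment {k R : ℝ} (hR : 0 ≤ R) {v : E3 → ℂ}
    (hv : ContDiffOn ℝ 2 v {x | R < ‖x‖}) (hrad : Radiating k v)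
    (p : MvPolynomial (Fin 3) ℂ) :
    Tendsto (fun r : ℝ => (r : ℂ) * (sphereMoment (radialDeriv v) p r -
      Complex.I * k * sphereMoment v p r)) atTop (𝓝 0) := by
  set K : ℝ := ∫ σ : S2, ‖polyFun p σ‖ ∂surf with hK
  have hK0 : 0 ≤ K := integral_nonneg fun σ => norm_nonneg _
  rw [Metric.tendsto_nhds]
  intro ε hε
  have hε' : 0 < ε / (K + 1) := by positivity
  have h1 := (Metric.tendsto_nhds.mp hrad) _ hε'
  rw [(hasBasis_cobounded_norm (E := E3)).eventually_iff] at h1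
  obtain ⟨M, -, hM⟩ := h1
  filter_upwards [eventually_ge_atTop M, eventually_gt_atTop R] with r hrM hrR
  have hr0 : 0 ≤ r := hR.trans hrR.le
  have e1 := integrable_moment hR hrR hv.continuousOn p
  have e2 := integrable_moment hR hrR (continuousOn_radialDeriv hR hv) p
  have heq : (r : ℂ) * (sphereMoment (radialDeriv v) p r - Complex.I * k * sphereMoment v p r) =
      ∫ σ : S2, ((r : ℂ) * (radialDeriv v (r • (σ : E3)) - Complex.I * k * v (r • (σ : E3)))) *
        polyFun p σ ∂surf := by
    rw [sphereMoment, sphereMoment, ← integral_const_mul, ← integral_sub e2 (e1.const_mul _),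
      ← integral_const_mul]
    congr 1 with σ
    ring
  rw [dist_zero_right, heq]
  refine (norm_integral_mul_polyFun_le p (C := ε / (K + 1)) fun σ => ?_).trans_lt ?_
  · have := hM (x := r • (σ : E3)) (by
      change M ≤ ‖r • (σ : E3)‖
      rwa [norm_smul_sphere hr0])
    rw [norm_smul_sphere hr0, dist_zero_right] at this
    exact this.le
  · rw [← hK, div_mul_eq_mul_div, div_lt_iff₀ (by positivity)]
    nlinarith

theorem norm_exp_neg_I_mul (s : ℝ) : ‖Complex.exp (-(Complex.I * s))‖ = 1 := by
  rw [Complex.norm_exp]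
  simp

theorem tendsto_exp_neg_mul_riccatiHankel_mul {k : ℝ} (hk : 0 < k) (n : ℕ) :
    Tendsto (fun r : ℝ => Complex.exp (-(Complex.I * (k * r : ℝ))) * riccatiHankel n (k * r)) atTop
      (𝓝 ((-Complex.I) ^ n)) :=
  (tendsto_exp_neg_mul_riccatiHankel n).comp (tendsto_id.const_mul_atTop hk)

theorem tendsto_radiation_radialProfile {k : ℝ} (hk : 0 < k) (n : ℕ) :
    Tendsto (fun r : ℝ => (r : ℂ) * (radialProfileDeriv k n r -
      Complex.I * k * radialProfile k n r)) atTop (𝓝 0) := by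
  have h0 := tendsto_exp_neg_mul_riccatiHankel_mul hk n
  have h1 := tendsto_exp_neg_mul_riccatiHankel_mul hk (n + 1)
  have h := (((tendsto_const_div_ofReal_atTop n).mul h0).sub (h1.const_mul (k : ℂ))).sub
    (h0.const_mul (Complex.I * k))
  have hz : (0 : ℂ) * (-Complex.I) ^ n - k * (-Complex.I) ^ (n + 1) -
      Complex.I * k * (-Complex.I) ^ n = 0 := by
    rw [pow_succ]
    ring
  rw [hz] at h
  rw [tendsto_zero_iff_norm_tendsto_zero] at h ⊢
  refine h.congr' ?_
  filter_upwards [eventually_gt_atTop 0] with r hr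
  have hr' : (r : ℂ) ≠ 0 := by exact_mod_cast hr.ne'
  -- The unimodular factor `exp(-ikr)` leaves the norm unchanged and cancels the oscillation, so
  -- that limits exist.
  rw [← one_mul ‖(r : ℂ) * _‖, ← norm_exp_neg_I_mul (k * r), ← norm_mul]
  congr 1
  simp only [radialProfileDeriv, radialProfile]
  field_simp

/-- Let `m` be the moment and `g` the radial profile. In `r²(g'm - gm')` both derivatives are `ik`
times the function up to `o(1/r)`, while `rm` and `rg` stay bounded; so the constant Wronskian is
zero. As `g` has no zeros, `m/g` has derivative zero. -/
theorem exists_sphereMoment_eq {k R : ℝ} (hk : 0 < k) (hR : 0 ≤ R) {v : E3 → ℂ}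
    (hv : ContDiffOn ℝ 2 v {x | R < ‖x‖})
    (hvH : ∀ x, R < ‖x‖ → Δ v x + (k : ℂ) ^ 2 * v x = 0) (hrad : Radiating k v)
    {n : ℕ} {p : MvPolynomial (Fin 3) ℂ} (hp : p ∈ harmonicPoly n) {a : ℂ}
    (ha : Tendsto (fun r : ℝ => (r : ℂ) * Complex.exp (-(Complex.I * (k * r : ℝ))) *
      sphereMoment v p r) atTop (𝓝 a)) :
    ∃ c : ℂ, ∀ r, R < r → sphereMoment v p r = c * radialProfile k n r := by
  obtain ⟨c, hc⟩ := exists_wronskian_eq hk.ne' hR hv hvH hp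
  have hc0 : c = 0 := by
    have h := (ha.mul (tendsto_radiation_radialProfile hk n)).sub
      ((tendsto_exp_neg_mul_riccatiHankel_mul hk n).mul (tendsto_radiation_moment hR hv hrad p))
    rw [mul_zero, mul_zero, sub_zero, tendsto_zero_iff_norm_tendsto_zero] at h
    have h' : Tendsto (fun _ : ℝ => ‖c‖) atTop (𝓝 0) := by
      refine h.congr' ?_
      filter_upwards [eventually_gt_atTop R] with r hr
      have hr' : (r : ℂ) ≠ 0 := by exact_mod_cast (hR.trans_lt hr).ne'
      rw [← one_mul ‖c‖, ← norm_exp_neg_I_mul (k * r), ← norm_mul, ← hc r hr]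
      congr 1
      simp only [radialProfile]
      field_simp
      ring
    exact norm_eq_zero.mp (tendsto_nhds_unique tendsto_const_nhds h')
  have hG {r : ℝ} (hr : R < r) := radialProfile_ne_zero hk (hR.trans_lt hr) n
  have hder {r : ℝ} (hr : R < r) :
      HasDerivAt (fun s => sphereMoment v p s / radialProfile k n s) 0 r := by
    have h := (hasDerivAt_sphereMoment hR hr hv p).fun_div
      (hasDerivAt_radialProfile hk.ne' (hR.trans_lt hr).ne' n) (hG hr)
    refine h.congr_deriv ?_
    have h2 := hc r hr
    have hr' : (r : ℂ) ^ 2 ≠ 0 := pow_ne_zero _ (by exact_mod_cast (hR.trans_lt hr).ne')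
    rw [hc0, mul_eq_zero, or_iff_right hr'] at h2
    rw [div_eq_zero_iff]
    left
    linear_combination -h2
  obtain ⟨b, hb⟩ := isOpen_Ioi.exists_is_const_of_deriv_eq_zero (isPreconnected_Ioi (a := R))
    (fun r hr => (hder hr).differentiableAt.differentiableWithinAt) (fun r hr => (hder hr).deriv)
  exact ⟨b, fun r hr => (div_eq_iff (hG hr)).mp (hb r hr)⟩

/-- Both limits see the same constant `c`: `a = c (-i)^n` at infinity and `b = c ψ_n(kR)/R` at the
boundary. -/
theorem normSq_boundary_moment_eq {k R : ℝ} (hk : 0 < k) (hR : 0 < R) {v : E3 → ℂ}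
    (hv : ContDiffOn ℝ 2 v {x | R < ‖x‖})
    (hvH : ∀ x, R < ‖x‖ → Δ v x + (k : ℂ) ^ 2 * v x = 0) (hrad : Radiating k v)
    {n : ℕ} {p : MvPolynomial (Fin 3) ℂ} (hp : p ∈ harmonicPoly n) {a b : ℂ}
    (ha : Tendsto (fun r : ℝ => (r : ℂ) * Complex.exp (-(Complex.I * (k * r : ℝ))) *
      sphereMoment v p r) atTop (𝓝 a))
    (hb : Tendsto (sphereMoment v p) (𝓝[>] R) (𝓝 b)) :
    R ^ 2 * ‖b‖ ^ 2 = Complex.normSq (riccatiHankel n (k * R)) * ‖a‖ ^ 2 := by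
  obtain ⟨c, hc⟩ := exists_sphereMoment_eq hk hR.le hv hvH hrad hp ha
  have ha' : a = c * (-Complex.I) ^ n := by
    refine tendsto_nhds_unique ha
      (((tendsto_exp_neg_mul_riccatiHankel_mul hk n).const_mul c).congr' ?_)
    filter_upwards [eventually_gt_atTop R] with r hr
    have hr' : (r : ℂ) ≠ 0 := by exact_mod_cast (hR.trans hr).ne'
    rw [hc r hr, radialProfile]
    field_simp
  have hb' : b = c * radialProfile k n R := by
    refine tendsto_nhds_unique hb ((tendsto_nhdsWithin_of_tendsto_nhds
      ((hasDerivAt_radialProfile hk.ne' hR.ne' n).continuousAt.tendsto.const_mul c)).congr' ?_)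
    filter_upwards [self_mem_nhdsWithin] with r hr
    exact (hc r hr).symm
  have hRc : ‖(R : ℂ)‖ = R := by simp [abs_of_pos hR]
  rw [ha', hb', radialProfile, Complex.normSq_eq_norm_sq]
  simp only [norm_mul, norm_div, norm_pow, norm_neg, Complex.norm_I, one_pow, mul_one, hRc]
  field_simp

/-! ### Far-field and boundary limits of the moments. -/

theorem norm_mul_exp_mul_sub_le {k C r : ℝ} (hr : 0 < r) {z w : ℂ}
    (h : ‖z - Complex.exp (Complex.I * k * r) / r * w‖ ≤ C / r ^ 2) :
    ‖(r : ℂ) * Complex.exp (-(Complex.I * (k * r : ℝ))) * z - w‖ ≤ C / r := by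
  have hr' : (r : ℂ) ≠ 0 := by exact_mod_cast hr.ne'
  have he : Complex.exp (-(Complex.I * (k * r : ℝ))) * Complex.exp (Complex.I * k * r) = 1 := by
    rw [← Complex.exp_add]
    push_cast
    ring_nf
    simp
  generalize Complex.exp (Complex.I * (k : ℂ) * r) = X at h he
  have heq : (r : ℂ) * Complex.exp (-(Complex.I * (k * r : ℝ))) * z - w =
      (r : ℂ) * Complex.exp (-(Complex.I * (k * r : ℝ))) * (z - X / r * w) := by
    field_simp
    linear_combination w * he
  rw [heq, norm_mul, norm_mul, norm_exp_neg_I_mul, Complex.norm_real, Real.norm_of_nonneg hr.le,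
    mul_one]
  calc r * _ ≤ r * (C / r ^ 2) := by gcongr
    _ = C / r := by field_simp

theorem tendsto_moment_amplitude {k R : ℝ} (hR : 0 ≤ R) {v : E3 → ℂ}
    (hv : ContinuousOn v {x | R < ‖x‖}) {A : S2 → ℂ} (hA : IsScatteringAmplitude k v A)
    (p : MvPolynomial (Fin 3) ℂ) :
    Tendsto (fun r : ℝ => (r : ℂ) * Complex.exp (-(Complex.I * (k * r : ℝ))) *
      sphereMoment v p r) atTop (𝓝 (∫ σ : S2, A σ * polyFun p σ ∂surf)) := by
  obtain ⟨C, r₀, hr₀, hC⟩ := hA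
  have hlim : Tendsto (fun r : ℝ => C / r) atTop (𝓝 0) := tendsto_const_nhds.div_atTop tendsto_id
  -- The amplitude is a uniform limit of continuous functions; its continuity supplies the
  -- integrability used below.
  have hAc : Continuous A := by
    have hu : TendstoUniformly (fun (r : ℝ) (σ : S2) =>
        (r : ℂ) * Complex.exp (-(Complex.I * (k * r : ℝ))) * v (r • (σ : E3))) A atTop := by
      rw [Metric.tendstoUniformly_iff]
      intro ε hε
      filter_upwards [eventually_ge_atTop r₀, hlim.eventually (gt_mem_nhds hε)] with r hr hrε σ
      rw [dist_comm, dist_eq_norm]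
      exact (norm_mul_exp_mul_sub_le (hr₀.trans_le hr) (hC r hr σ)).trans_lt hrε
    refine hu.continuous (Eventually.frequently ?_)
    filter_upwards [eventually_gt_atTop R] with r hr
    exact continuous_const.mul (continuous_comp_smul_sphere hR hr hv)
  rw [tendsto_iff_norm_sub_tendsto_zero]
  have hb := hlim.mul_const (∫ σ : S2, ‖polyFun p σ‖ ∂surf)
  rw [zero_mul] at hb
  refine squeeze_zero' (.of_forall fun r => norm_nonneg _) ?_ hb
  filter_upwards [eventually_ge_atTop r₀, eventually_gt_atTop R] with r hr hrR
  have h1 := integrable_moment hR hrR hv p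
  have h2 : Integrable (fun σ : S2 => A σ * polyFun p σ) surf :=
    integrable_of_continuous_sphere (hAc.mul (continuous_polyFun_sphere p))
  rw [sphereMoment, ← integral_const_mul, ← integral_sub (h1.const_mul _) h2]
  refine (le_of_eq ?_).trans (norm_integral_mul_polyFun_le p
    fun σ => norm_mul_exp_mul_sub_le (hr₀.trans_le hr) (hC r hr σ))
  congr 2 with σ
  ring

theorem tendsto_moment_boundary {R : ℝ} (hR : 0 ≤ R) {v : E3 → ℂ}
    (hv : ContinuousOn v {x | R < ‖x‖}) {h : S2 → ℂ} (hh : MemLp h 2 surf)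
    (hlim : Tendsto (fun ρ : ℝ => eLpNorm (fun σ : S2 => v (ρ • (σ : E3)) - h σ) 2 surf)
      (𝓝[>] R) (𝓝 0)) (p : MvPolynomial (Fin 3) ℂ) :
    Tendsto (sphereMoment v p) (𝓝[>] R) (𝓝 (∫ σ : S2, h σ * polyFun p σ ∂surf)) := by
  have hP : MemLp (fun σ : S2 => polyFun p σ) 2 surf :=
    (continuous_polyFun_sphere p).memLp_of_hasCompactSupport (HasCompactSupport.of_compactSpace _)
  rw [tendsto_iff_edist_tendsto_0]
  have hb := ENNReal.Tendsto.const_mul (a := eLpNorm (fun σ : S2 => polyFun p σ) 2 surf) hlim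
    (Or.inr hP.eLpNorm_ne_top)
  rw [mul_zero] at hb
  refine tendsto_of_tendsto_of_tendsto_of_le_of_le' tendsto_const_nhds hb
    (.of_forall fun _ => zero_le) ?_
  filter_upwards [self_mem_nhdsWithin] with ρ hρ
  have h1 := integrable_moment hR hρ hv p
  have h2 : Integrable (fun σ : S2 => h σ * polyFun p σ) surf := hh.integrable_mul hP
  have hm : AEStronglyMeasurable (fun σ : S2 => v (ρ • (σ : E3)) - h σ) surf :=
    (continuous_comp_smul_sphere hR hρ hv).aestronglyMeasurable.sub hh.aestronglyMeasurable
  rw [edist_eq_enorm_sub, sphereMoment, ← integral_sub h1 h2]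
  refine (enorm_integral_le_lintegral_enorm _).trans ?_
  rw [← eLpNorm_one_eq_lintegral_enorm]
  refine (le_of_eq ?_).trans (eLpNorm_smul_le_mul_eLpNorm (r := 1) hm hP.aestronglyMeasurable)
  congr 1 with σ
  simp only [Pi.smul_apply', smul_eq_mul]
  ring

/-! ### From moments to the coefficients of `d` and `A`. -/

theorem radialDeriv_sphericalWave {k R : ℝ} (hR : 0 < R) (σ : S2) :
    radialDeriv (sphericalWave k R) (R • (σ : E3)) = Complex.I * k - 1 / R := by
  have hR' : (R : ℂ) ≠ 0 := by exact_mod_cast hR.ne'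
  have hx : R • (σ : E3) ≠ 0 := by
    rw [← norm_ne_zero_iff, norm_smul_sphere hR.le]
    exact hR.ne'
  have hprofile {s : ℝ} (hs : 0 < s) : HasDerivAt
      (fun s : ℝ => (R : ℂ) / Complex.exp (Complex.I * k * R) *
        (Complex.exp (Complex.I * k * s) / s))
      ((R : ℂ) / Complex.exp (Complex.I * k * R) *
        ((Complex.exp (Complex.I * k * s) * (Complex.I * k) * s -
          Complex.exp (Complex.I * k * s)) / (s : ℂ) ^ 2)) s := by
    have hs' : (s : ℂ) ≠ 0 := by exact_mod_cast hs.ne'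
    have hof := Complex.ofRealCLM.hasDerivAt (x := s)
    have h := (((hof.const_mul (Complex.I * k)).cexp.fun_div hof (by simpa using hs')).const_mul
      ((R : ℂ) / Complex.exp (Complex.I * k * R)))
    simpa using h
  have hdiff : DifferentiableAt ℝ (sphericalWave k R) (R • (σ : E3)) :=
    ((hprofile (norm_pos_iff.mpr hx)).hasFDerivAt.comp _
      (hasFDerivAt_norm_of_ne hx)).differentiableAt
  have h1 := hasDerivAt_comp_smul_sphere hR hdiff
  have h2 : HasDerivAt (fun s : ℝ => sphericalWave k R (s • (σ : E3))) _ R :=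
    (hprofile hR).congr_of_eventuallyEq ((eventually_gt_nhds hR).mono fun s hs => by
      simp only [sphericalWave, norm_smul_sphere hs.le])
  rw [h1.unique h2]
  have := Complex.exp_ne_zero (Complex.I * k * R)
  field_simp

theorem map_conj_mem_harmonicPoly {n : ℕ} {p : MvPolynomial (Fin 3) ℂ}
    (hp : p ∈ harmonicPoly n) : MvPolynomial.map (starRingEnd ℂ) p ∈ harmonicPoly n := by
  refine ⟨MvPolynomial.IsHomogeneous.map hp.1 _, LinearMap.mem_ker.mpr ?_⟩
  have h := congrArg (MvPolynomial.map (starRingEnd ℂ)) (LinearMap.mem_ker.mp hp.2)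
  simpa [polyLaplacian, MvPolynomial.pderiv_map] using h

theorem polyFun_map_conj (p : MvPolynomial (Fin 3) ℂ) (x : E3) :
    polyFun (MvPolynomial.map (starRingEnd ℂ) p) x = starRingEnd ℂ (polyFun p x) := by
  rw [polyFun, polyFun, MvPolynomial.eval_map, MvPolynomial.eval, MvPolynomial.coe_eval₂Hom,
    MvPolynomial.eval₂_comp_right, MvPolynomial.eval₂_map]
  simp [Function.comp_def]

/-- The coefficient integrates against the conjugate of `Y n m`, and conjugating the coefficients of
a polynomial preserves harmonicity and degree. -/
theorem exists_harmonicPoly_coeff_eq (n : ℕ)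
    (m : Fin (Module.finrank ℂ (sphericalHarmonics n))) :
    ∃ p ∈ harmonicPoly n, ∀ f : S2 → ℂ, coeff f n m = ∫ σ : S2, f σ * polyFun p σ ∂surf := by
  obtain ⟨p, hp, hpY⟩ :=
    (stdOrthonormalBasis ℂ (sphericalHarmonics n) m : sphericalHarmonics n).2
  refine ⟨_, map_conj_mem_harmonicPoly hp, fun f => ?_⟩
  have hae : Y n m =ᵐ[surf] fun σ : S2 => polyFun p σ := by
    rw [Y, ← hpY]
    exact ContinuousMap.coeFn_toLp surf (restrictSphere p)
  refine integral_congr_ae (hae.mono fun σ hσ => ?_)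
  simp only [polyFun_map_conj, hσ]

theorem mul_degreeSize_sq_eq {k R : ℝ} (hk : 0 < k) (hR : 0 < R) {d : S2 → ℝ}
    (hd : MemLp (fun σ => (d σ : ℂ)) 2 surf) {v : E3 → ℂ}
    (hv : IsLinearizedSoftSolution k R d v) {A : S2 → ℂ} (hA : IsScatteringAmplitude k v A)
    (n : ℕ) :
    ((k * R) ^ 2 + 1) * degreeSize (fun σ => (d σ : ℂ)) n ^ 2 =
      Complex.normSq (riccatiHankel n (k * R)) * degreeSize A n ^ 2 := by
  have hsq (f : S2 → ℂ) : degreeSize f n ^ 2 = ∑ m, ‖coeff f n m‖ ^ 2 :=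
    Real.sq_sqrt (Finset.sum_nonneg fun m _ => sq_nonneg _)
  rw [hsq, hsq, Finset.mul_sum, Finset.mul_sum]
  refine Finset.sum_congr rfl fun m _ => ?_
  obtain ⟨p, hp, hcoeff⟩ := exists_harmonicPoly_coeff_eq n m
  have hbd : Tendsto (sphereMoment v p) (𝓝[>] R)
      (𝓝 (∫ σ : S2, -(d σ : ℂ) * (Complex.I * k - 1 / R) * polyFun p σ ∂surf)) := by
    refine tendsto_moment_boundary hR.le hv.contDiffOn.continuousOn ?_ ?_ p
    · simpa [mul_comm] using (hd.neg.const_mul (Complex.I * k - 1 / R))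
    · simpa only [radialDeriv_sphericalWave hR] using hv.boundary
  have hmain := normSq_boundary_moment_eq hk hR hv.contDiffOn hv.helmholtz hv.radiation hp
    (tendsto_moment_amplitude hR.le hv.contDiffOn.continuousOn hA p) hbd
  rw [← hcoeff A] at hmain
  rw [← hmain]
  have hint : ∫ σ : S2, -(d σ : ℂ) * (Complex.I * k - 1 / R) * polyFun p σ ∂surf =
      -(Complex.I * k - 1 / R) * coeff (fun σ => (d σ : ℂ)) n m := by
    rw [hcoeff, ← integral_const_mul]
    congr 1 with σ
    ring
  have hnorm : ‖Complex.I * k - 1 / (R : ℂ)‖ ^ 2 = k ^ 2 + 1 / R ^ 2 := by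
    rw [← Complex.normSq_eq_norm_sq]
    have : Complex.I * k - 1 / (R : ℂ) = ((-(1 / R) : ℝ) : ℂ) + (k : ℝ) * Complex.I := by
      push_cast
      ring
    rw [this, Complex.normSq_add_mul_I]
    ring
  rw [hint, norm_mul, norm_neg, mul_pow ‖_‖, hnorm]
  field_simp

/-! ### Summation over the degrees -/

theorem tsum_tail_le_tsum {f : ℕ → ℝ} (hf : Summable f) (h0 : ∀ n, 0 ≤ f n) (N : ℕ) :
    ∑' n, f (N + n) ≤ ∑' n, f n := by
  have h := hf.sum_add_tsum_nat_add N
  have : 0 ≤ ∑ i ∈ Finset.range N, f i := Finset.sum_nonneg fun i _ => h0 i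
  simp only [add_comm N]
  linarith

theorem summable_tail {f : ℕ → ℝ} (hf : Summable f) (N : ℕ) : Summable fun n => f (N + n) := by
  simpa only [add_comm N] using (summable_nat_add_iff N).mpr hf

/-- Where `n² ≥ F` one has `x n ≤ n² x n / F`; elsewhere the hypothesis applies. Adding both bounds
covers every degree. -/
theorem tsum_tail_le {x y : ℕ → ℝ} {N : ℕ} {α β F : ℝ} (hx0 : ∀ n, 0 ≤ x n) (hy0 : ∀ n, 0 ≤ y n)
    (hx : Summable x) (hy : Summable y) (hx2 : Summable fun n : ℕ => (n : ℝ) ^ 2 * x n)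
    (hF : 0 < F) (hα : 0 ≤ α) (hβ : 0 ≤ β)
    (h : ∀ n, N ≤ n → (n : ℝ) ^ 2 < F → x n ≤ α * x n + β * y n) :
    ∑' n, x (N + n) ≤ α * ∑' n, x (N + n) + β * ∑' n, y (N + n) +
      (∑' n : ℕ, (n : ℝ) ^ 2 * x n) / F := by
  have hp (n : ℕ) : x (N + n) ≤ α * x (N + n) + β * y (N + n) +
      (((N + n : ℕ) : ℝ) ^ 2 * x (N + n)) / F := by
    have hxn := hx0 (N + n)
    have hyn := hy0 (N + n)
    rcases lt_or_ge (((N + n : ℕ) : ℝ) ^ 2) F with hlt | hge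
    · have h1 := h (N + n) (by omega) hlt
      have h2 : 0 ≤ (((N + n : ℕ) : ℝ) ^ 2 * x (N + n)) / F := by positivity
      linarith
    · have h1 : x (N + n) ≤ (((N + n : ℕ) : ℝ) ^ 2 * x (N + n)) / F := by
        rw [le_div_iff₀ hF]
        nlinarith
      have h2 : 0 ≤ α * x (N + n) + β * y (N + n) := by positivity
      linarith
  have s1 := (summable_tail hx N).mul_left α
  have s2 := (summable_tail hy N).mul_left β
  have s3 := summable_tail hx2 N
  refine ((summable_tail hx N).tsum_le_tsum hp ((s1.add s2).add (s3.div_const F))).trans ?_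
  rw [(s1.add s2).tsum_add (s3.div_const F), s1.tsum_add s2, tsum_mul_left, tsum_mul_left,
    tsum_div_const]
  have h1 := tsum_tail_le_tsum hx2 (fun n => by have := hx0 n; positivity) N
  have h2 := div_le_div_of_nonneg_right h1 hF.le
  linarith

/-- Multiplying the relation by `x` gives `x² ≤ 4αβxy ≤ (αx + βy)²`. -/
theorem le_of_four_mul_mul {x y M T α β : ℝ} (hx : 0 ≤ x) (hy : 0 ≤ y) (hT : 0 < T) (hα : 0 ≤ α)
    (hβ : 0 ≤ β) (h : T * x = M * y) (hM : M ≤ 4 * α * β * T) : x ≤ α * x + β * y := by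
  rw [← sq_le_sq₀ hx (by positivity)]
  have h1 : T * x ^ 2 ≤ T * (4 * α * β * x * y) := by
    calc T * x ^ 2 = M * (x * y) := by linear_combination x * h
      _ ≤ 4 * α * β * T * (x * y) := by gcongr
      _ = _ := by ring
  have h2 := le_of_mul_le_mul_left h1 hT
  nlinarith [sq_nonneg (α * x - β * y)]

theorem sobolevNorm_sq {l : ℕ} {R : ℝ} {f : S2 → ℂ} (hR : 0 < R) :
    sobolevNorm l R f ^ 2 = sobolevNormSq l R f :=
  Real.sq_sqrt (mul_nonneg (sq_nonneg R) (Finset.sum_nonneg fun j _ =>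
    tsum_nonneg fun n => by positivity))

theorem sobolevNorm_zero_sq {R : ℝ} {f : S2 → ℂ} (hR : 0 < R) :
    sobolevNorm 0 R f ^ 2 = R ^ 2 * ∑' n, degreeSize f n ^ 2 := by
  rw [sobolevNorm_sq hR]
  simp [sobolevNormSq]

theorem sobolevNorm_one_sq {R : ℝ} {f : S2 → ℂ} (hR : 0 < R) :
    sobolevNorm 1 R f ^ 2 =
      R ^ 2 * ∑' n, degreeSize f n ^ 2 + ∑' n : ℕ, (n : ℝ) ^ 2 * degreeSize f n ^ 2 := by
  rw [sobolevNorm_sq hR, sobolevNormSq, Finset.sum_range_succ, Finset.sum_range_one, mul_add]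
  congr 1
  · simp
  · rw [← tsum_mul_left]
    congr 1 with n
    simp only [mul_one]
    field_simp

/-- Control of the tail of `x` by that of `y`, for three choices of the interpolation. -/
theorem tail_estimates {k R E e D κ : ℝ} {N : ℕ} {x y M : ℕ → ℝ} (hk : 0 < k) (hR : 0 < R)
    (hkR : 2 ≤ k * R) (hx0 : ∀ n, 0 ≤ x n) (hy0 : ∀ n, 0 ≤ y n) (hx : Summable x) (hy : Summable y)
    (hx2 : Summable fun n : ℕ => (n : ℝ) ^ 2 * x n)
    (hxy : ∀ n, (k ^ 2 * R ^ 2 + 1) * x n = M n * y n)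
    (hM : ∀ n : ℕ, M n ≤ Real.exp ((n : ℝ) ^ 2 / (k * R)))
    (hN : ∀ n : ℕ, N ≤ n → k * R < (n : ℝ) ^ 2) (hE : 0 ≤ E) (he : e = Real.exp (-E))
    (hye : ∑' n, y (N + n) = e ^ 2) (hD : 0 ≤ D)
    (hD2 : D ^ 2 = R ^ 2 * ∑' n, x n + ∑' n : ℕ, (n : ℝ) ^ 2 * x n)
    (hκ : 0 ≤ κ) (hκ2 : κ ^ 2 = 2 * (k ^ 2 * R ^ 2 + 1) / (Real.pi * k * R)) :
    (∑' n, x (N + n) ≤ 2 / Real.pi * Real.exp (2 / R) * e / (k ^ 2 * R ^ 2 + 1) +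
      D ^ 2 / (E + k)) ∧
    (∑' n, x (N + n) ≤ κ * Real.exp (1 / R) * Real.exp (-E / 2) / (k ^ 2 * R ^ 2 + 1) +
      D ^ 2 / (E + k)) ∧
    (∑' n, x (N + n) ≤ κ * Real.exp (1 / R) * D * Real.exp (-E / 2) / (k ^ 2 * R ^ 2 + 1) +
      D ^ 2 / (E + k)) := by
  set T : ℝ := k ^ 2 * R ^ 2 + 1 with hTdef
  have hT : 0 < T := by positivity
  have hkR0 : 0 < k * R := by positivity
  have hF : 0 < E + k := by positivity
  have hπ := Real.pi_pos
  set S := ∑' n, x n with hS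
  set P := ∑' n : ℕ, (n : ℝ) ^ 2 * x n with hP
  set H := ∑' n, x (N + n) with hH
  have hS0 : 0 ≤ S := tsum_nonneg hx0
  have hP0 : 0 ≤ P := tsum_nonneg fun n => by have := hx0 n; positivity
  have hPD : P / (E + k) ≤ D ^ 2 / (E + k) := by
    gcongr
    rw [hD2]
    have : 0 ≤ R ^ 2 * S := by positivity
    linarith
  have hM1 (n : ℕ) (hn : (n : ℝ) ^ 2 < E + k) : M n ≤ Real.exp (1 / R + E / 2) := by
    refine (hM n).trans (Real.exp_le_exp.mpr ?_)
    rw [div_le_iff₀ hkR0]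
    have : (1 / R + E / 2) * (k * R) = k + E * (k * R / 2) := by field_simp
    rw [this]
    nlinarith
  -- If a degree lies in the middle range then `1 < n²/(kR) ≤ 1/R + E/2`, so `exp(1/R + E/2) ≥ 2 ≥
  -- π/2`. Squaring this exponential therefore pays for the factor `2/π`.
  have hM2 (n : ℕ) (hNn : N ≤ n) (hn : (n : ℝ) ^ 2 < E + k) :
      M n ≤ 2 / Real.pi * Real.exp (2 / R + E) := by
    have h1 : 1 ≤ (n : ℝ) ^ 2 / (k * R) := by
      rw [le_div_iff₀ hkR0]
      linarith [hN n hNn]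
    have h2 : Real.pi / 2 ≤ Real.exp (1 / R + E / 2) := by
      have h3 : (n : ℝ) ^ 2 / (k * R) ≤ 1 / R + E / 2 := by
        rw [div_le_iff₀ hkR0]
        have : (1 / R + E / 2) * (k * R) = k + E * (k * R / 2) := by field_simp
        rw [this]
        nlinarith
      have h4 := Real.add_one_le_exp (1 / R + E / 2)
      linarith [Real.pi_lt_four]
    have h5 : Real.exp (2 / R + E) = Real.exp (1 / R + E / 2) * Real.exp (1 / R + E / 2) := by
      rw [← Real.exp_add]
      ring_nf
    calc M n ≤ 1 * Real.exp (1 / R + E / 2) := by rw [one_mul]; exact hM1 n hn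
      _ ≤ (2 / Real.pi * Real.exp (1 / R + E / 2)) * Real.exp (1 / R + E / 2) := by
          gcongr
          rw [div_mul_eq_mul_div, le_div_iff₀ hπ]
          linarith
      _ = _ := by rw [h5]; ring
  have hdirect {K : ℝ} (hK : 0 ≤ K) (h : ∀ n, N ≤ n → (n : ℝ) ^ 2 < E + k → M n ≤ K) :
      H ≤ K * e ^ 2 / T + D ^ 2 / (E + k) := by
    have h1 := tsum_tail_le (α := 0) (β := K / T) hx0 hy0 hx hy hx2 hF le_rfl (by positivity)
      fun n hNn hn => by
        rw [zero_mul, zero_add, div_mul_eq_mul_div, le_div_iff₀ hT, mul_comm, hxy]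
        exact mul_le_mul_of_nonneg_right (h n hNn hn) (hy0 n)
    rw [hye, ← hH, ← hP] at h1
    calc H ≤ 0 * H + K / T * e ^ 2 + P / (E + k) := h1
      _ = K * e ^ 2 / T + P / (E + k) := by ring
      _ ≤ _ := by gcongr
  have he2 : e ^ 2 = Real.exp (-(2 * E)) := by rw [he, ← Real.exp_nat_mul]; ring_nf
  refine ⟨?_, ?_, ?_⟩
  · refine (hdirect (by positivity) hM2).trans (le_of_eq ?_)
    have h1 : Real.exp (2 / R + E) * e ^ 2 = Real.exp (2 / R) * e := by
      rw [he2, he, ← Real.exp_add, ← Real.exp_add]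
      ring_nf
    rw [mul_assoc (2 / Real.pi), h1, ← mul_assoc]
  · refine (hdirect (by positivity) fun n _ => hM1 n).trans ?_
    -- With `s = kR ≥ 2` this is `2(s² + 1) ≥ πs`; the direct bound is sharper than the one stated
    -- with `κ`.
    have hκ1 : 1 ≤ κ := by
      rw [← sq_le_sq₀ zero_le_one hκ, hκ2, one_pow, le_div_iff₀ (by positivity), one_mul, hTdef]
      nlinarith [Real.pi_lt_four]
    refine add_le_add (div_le_div_of_nonneg_right ?_ hT.le) le_rfl
    calc Real.exp (1 / R + E / 2) * e ^ 2 ≤ Real.exp (1 / R) * Real.exp (-E / 2) := by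
          rw [he2, ← Real.exp_add, ← Real.exp_add]
          exact Real.exp_le_exp.mpr (by linarith)
      _ ≤ κ * Real.exp (1 / R) * Real.exp (-E / 2) := by
          rw [mul_assoc]
          exact le_mul_of_one_le_left (by positivity) hκ1
  -- The weight `α` below divides by `D`; if `D = 0` then every coefficient of `d` vanishes.
  · rcases hD.eq_or_lt with hD0 | hDpos
    · have hHS : H ≤ S := tsum_tail_le_tsum hx hx0 N
      have hSz : S ≤ 0 := by
        rw [← hD0] at hD2
        by_contra hcon
        have : 0 < R ^ 2 * S := mul_pos (by positivity) (not_le.mp hcon)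
        linarith
      rw [← hD0]
      simp only [mul_zero, zero_mul, zero_div, ne_eq, OfNat.ofNat_ne_zero, not_false_eq_true,
        zero_pow, add_zero]
      linarith
    -- The weights are balanced so that `4αβT` is the bound of `hM2`, by `κ² kR/T = 2/π`, and so
    -- that `α D²/(kR)` and `β e²` are each half of the target term.
    · set α : ℝ := k * R / D * κ / T * Real.exp (1 / R - E / 2) / 2 with hα
      set β : ℝ := D * κ / T * Real.exp (1 / R + 3 * E / 2) / 2 with hβ
      have hαβ : 4 * α * β * T = 2 / Real.pi * Real.exp (2 / R + E) := by
        have h5 : Real.exp (2 / R + E) =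
            Real.exp (1 / R - E / 2) * Real.exp (1 / R + 3 * E / 2) := by
          rw [← Real.exp_add]
          ring_nf
        have h6 : 4 * α * β * T = κ ^ 2 * (k * R / T) *
            (Real.exp (1 / R - E / 2) * Real.exp (1 / R + 3 * E / 2)) := by
          rw [hα, hβ]
          field_simp
          ring
        rw [h6, hκ2, ← h5]
        field_simp
      have h1 := tsum_tail_le (α := α) (β := β) hx0 hy0 hx hy hx2 hF (by positivity) (by positivity)
        fun n hNn hn => le_of_four_mul_mul (hx0 n) (hy0 n) hT (by positivity) (by positivity)
          (hxy n) (by rw [hαβ]; exact hM2 n hNn hn)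
      rw [hye, ← hH, ← hP] at h1
      -- On the tail `n² > kR`, so the `H¹` norm also controls `H` itself; this bounds the term
      -- `αH`.
      have hHP : H ≤ D ^ 2 / (k * R) := by
        rw [le_div_iff₀ hkR0]
        calc H * (k * R) = ∑' n, x (N + n) * (k * R) := tsum_mul_right.symm
          _ ≤ ∑' n, ((N + n : ℕ) : ℝ) ^ 2 * x (N + n) :=
            ((summable_tail hx N).mul_right _).tsum_le_tsum (fun n => by
              rw [mul_comm]
              exact mul_le_mul_of_nonneg_right (hN (N + n) (by omega)).le (hx0 _))
              (summable_tail hx2 N)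
          _ ≤ P := tsum_tail_le_tsum hx2 (fun n => by have := hx0 n; positivity) N
          _ ≤ D ^ 2 := by
            rw [hD2]
            have : 0 ≤ R ^ 2 * S := by positivity
            linarith
      have hα' : α * (D ^ 2 / (k * R)) =
          κ * Real.exp (1 / R) * D * Real.exp (-E / 2) / T / 2 := by
        have : Real.exp (1 / R - E / 2) = Real.exp (1 / R) * Real.exp (-E / 2) := by
          rw [← Real.exp_add]
          ring_nf
        rw [hα, this]
        field_simp
      have hβ' : β * e ^ 2 = κ * Real.exp (1 / R) * D * Real.exp (-E / 2) / T / 2 := by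
        have : Real.exp (1 / R + 3 * E / 2) * e ^ 2 = Real.exp (1 / R) * Real.exp (-E / 2) := by
          rw [he2, ← Real.exp_add, ← Real.exp_add]
          ring_nf
        calc β * e ^ 2 = D * κ / T * (Real.exp (1 / R + 3 * E / 2) * e ^ 2) / 2 := by
              rw [hβ]; ring
          _ = _ := by rw [this]; ring
      have hαH : α * H ≤ α * (D ^ 2 / (k * R)) := by gcongr
      linarith

end FarField

end

/-! ### Low and high degrees combined. -/

theorem corollary4p1 (k R : ℝ) (hR : 0 < R) (hkR : 2 ≤ k * R)
    (d : FarField.S2 → ℝ) (hd : FarField.MemH1 (fun σ => (d σ : ℂ)))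
    (v₀ : FarField.E3 → ℂ) (hv₀ : FarField.IsLinearizedSoftSolution k R d v₀)
    (A : FarField.S2 → ℂ) (hA : FarField.IsScatteringAmplitude k v₀ A)
    (hε : FarField.eps2 k R A ≤ 1) :
    (FarField.sobolevNorm 0 R (fun σ => (d σ : ℂ)) ^ 2 ≤
      R ^ 2 / (k ^ 2 * R ^ 2 + 1) *
        (2 * Real.exp 1 ^ 2 / Real.pi * FarField.eps1 k R A ^ 2 +
          2 / Real.pi * Real.exp (2 / R) * FarField.eps2 k R A) +
      R ^ 2 * FarField.sobolevNorm 1 R (fun σ => (d σ : ℂ)) ^ 2 *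
        FarField.invEnergy k (FarField.eps2 k R A)) ∧
    (FarField.sobolevNorm 0 R (fun σ => (d σ : ℂ)) ^ 2 ≤
      R ^ 2 / (k ^ 2 * R ^ 2 + 1) *
        (2 * Real.exp 1 ^ 2 / Real.pi * FarField.eps1 k R A ^ 2 +
          Real.sqrt (2 * (k ^ 2 * R ^ 2 + 1) / (Real.pi * k * R)) * Real.exp (1 / R) *
            FarField.eps2 k R A ^ (1 / 2 : ℝ)) +
      R ^ 2 * FarField.sobolevNorm 1 R (fun σ => (d σ : ℂ)) ^ 2 *
        FarField.invEnergy k (FarField.eps2 k R A)) ∧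
    (FarField.sobolevNorm 0 R (fun σ => (d σ : ℂ)) ^ 2 ≤
      R ^ 2 / (k ^ 2 * R ^ 2 + 1) *
        (2 * Real.exp 1 ^ 2 / Real.pi * FarField.eps1 k R A ^ 2 +
          Real.sqrt (2 * (k ^ 2 * R ^ 2 + 1) / (Real.pi * k * R)) * Real.exp (1 / R) *
            FarField.sobolevNorm 1 R (fun σ => (d σ : ℂ)) *
            FarField.eps2 k R A ^ (1 / 2 : ℝ)) +
      R ^ 2 * FarField.sobolevNorm 1 R (fun σ => (d σ : ℂ)) ^ 2 *
        FarField.invEnergy k (FarField.eps2 k R A)) := by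
  have hk : 0 < k := pos_of_mul_pos_left (by linarith) hR.le
  have hkR0 : 0 < k * R := by linarith
  set x : ℕ → ℝ := fun n => FarField.degreeSize (fun σ => (d σ : ℂ)) n ^ 2 with hxdef
  set y : ℕ → ℝ := fun n => FarField.degreeSize A n ^ 2 with hydef
  set M : ℕ → ℝ := fun n => Complex.normSq (FarField.riccatiHankel n (k * R)) with hMdef
  have hx0 (n) : 0 ≤ x n := sq_nonneg _
  have hy0 (n) : 0 ≤ y n := sq_nonneg _
  have hxy (n) : (k ^ 2 * R ^ 2 + 1) * x n = M n * y n := by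
    have h := FarField.mul_degreeSize_sq_eq hk hR hd.1 hv₀ hA n
    rwa [mul_pow] at h
  have hM (n : ℕ) : M n ≤ Real.exp ((n : ℝ) ^ 2 / (k * R)) :=
    FarField.normSq_riccatiHankel_le n (by linarith)
  have hM1 (n : ℕ) : 1 ≤ M n := FarField.one_le_normSq_riccatiHankel n hkR0
  have hx2 : Summable fun n : ℕ => (n : ℝ) ^ 2 * x n := hd.2
  -- The weight `n²` is at least `1` except at `n = 0`, hence the shift by one.
  have hx : Summable x := by
    refine (summable_nat_add_iff 1).mp (Summable.of_nonneg_of_le (fun n => hx0 _) (fun n => ?_)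
      ((summable_nat_add_iff 1).mpr hx2))
    have : (1 : ℝ) ≤ ((n + 1 : ℕ) : ℝ) ^ 2 := one_le_pow₀ (by simp)
    exact le_mul_of_one_le_left (hx0 _) this
  -- The lower bound `1 ≤ M n` gives `y n ≤ (k²R² + 1) x n`. Summability matters: the sum in `eps2`
  -- would otherwise take the default value `0`.
  have hy : Summable y := Summable.of_nonneg_of_le hy0
    (fun n => (le_mul_of_one_le_left (hy0 n) (hM1 n)).trans (hxy n).ge) (hx.mul_left _)
  set N := FarField.cutoff k R + 1 with hNdef
  have hN (n : ℕ) (hn : N ≤ n) : k * R < (n : ℝ) ^ 2 := by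
    have h : FarField.cutoff k R < n := hn
    rw [FarField.cutoff, Nat.floor_lt (Real.sqrt_nonneg _)] at h
    exact (Real.sqrt_lt' ((Real.sqrt_nonneg _).trans_lt h)).mp h
  have hlow (n : ℕ) (hn : n < N) : (n : ℝ) ^ 2 ≤ k * R := by
    have h : n ≤ FarField.cutoff k R := Nat.lt_succ_iff.mp hn
    rw [FarField.cutoff, Nat.le_floor_iff (Real.sqrt_nonneg _)] at h
    calc (n : ℝ) ^ 2 ≤ Real.sqrt (k * R) ^ 2 := by gcongr
      _ = k * R := Real.sq_sqrt hkR0.le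
  set D := FarField.sobolevNorm 1 R (fun σ => (d σ : ℂ)) with hDdef
  have hD0 : 0 ≤ D := Real.sqrt_nonneg _
  have hD2 : D ^ 2 = R ^ 2 * ∑' n, x n + ∑' n : ℕ, (n : ℝ) ^ 2 * x n :=
    FarField.sobolevNorm_one_sq hR
  have he1 : FarField.eps1 k R A ^ 2 = ∑ n ∈ Finset.range N, y n :=
    Real.sq_sqrt (Finset.sum_nonneg fun n _ => hy0 n)
  set e := FarField.eps2 k R A with hedef
  have he0 : 0 ≤ e := Real.sqrt_nonneg _
  have he2 : ∑' n, y (N + n) = e ^ 2 := (Real.sq_sqrt (tsum_nonneg fun n => hy0 _)).symm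
  set κ := Real.sqrt (2 * (k ^ 2 * R ^ 2 + 1) / (Real.pi * k * R)) with hκdef
  have hπ := Real.pi_pos
  have hκ2 : κ ^ 2 = 2 * (k ^ 2 * R ^ 2 + 1) / (Real.pi * k * R) := Real.sq_sqrt (by positivity)
  have hκ0 : 0 ≤ κ := Real.sqrt_nonneg _
  have hT : 0 < k ^ 2 * R ^ 2 + 1 := by positivity
  have hlowsum : ∑ n ∈ Finset.range N, x n ≤
      2 * Real.exp 1 ^ 2 / Real.pi * FarField.eps1 k R A ^ 2 / (k ^ 2 * R ^ 2 + 1) := by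
    rw [he1, le_div_iff₀ hT, Finset.sum_mul, Finset.mul_sum]
    refine Finset.sum_le_sum fun n hn => ?_
    rw [mul_comm, hxy]
    refine mul_le_mul_of_nonneg_right ?_ (hy0 n)
    calc M n ≤ Real.exp ((n : ℝ) ^ 2 / (k * R)) := hM n
      _ ≤ Real.exp 1 := by
        gcongr
        exact (div_le_one₀ hkR0).mpr (hlow n (Finset.mem_range.mp hn))
      -- This is `π ≤ 4 ≤ 2e`.
      _ ≤ 2 * Real.exp 1 ^ 2 / Real.pi := by
        rw [le_div_iff₀ hπ, sq, ← mul_assoc, mul_comm]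
        gcongr
        linarith [Real.add_one_le_exp 1, Real.pi_le_four]
  have hsplit : ∑ n ∈ Finset.range N, x n + ∑' n, x (N + n) = ∑' n, x n := by
    simpa only [add_comm N] using hx.sum_add_tsum_nat_add N
  have hfinish {Z I : ℝ} (h : ∑' n, x (N + n) ≤ Z / (k ^ 2 * R ^ 2 + 1) + D ^ 2 * I) :
      FarField.sobolevNorm 0 R (fun σ => (d σ : ℂ)) ^ 2 ≤
        R ^ 2 / (k ^ 2 * R ^ 2 + 1) *
          (2 * Real.exp 1 ^ 2 / Real.pi * FarField.eps1 k R A ^ 2 + Z) + R ^ 2 * D ^ 2 * I := by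
    rw [FarField.sobolevNorm_zero_sq hR]
    calc R ^ 2 * ∑' n, x n ≤ R ^ 2 * (2 * Real.exp 1 ^ 2 / Real.pi * FarField.eps1 k R A ^ 2 /
          (k ^ 2 * R ^ 2 + 1) + (Z / (k ^ 2 * R ^ 2 + 1) + D ^ 2 * I)) := by
          rw [← hsplit]
          exact mul_le_mul_of_nonneg_left (add_le_add hlowsum h) (sq_nonneg R)
      _ = _ := by ring
  rcases he0.eq_or_lt with he | he
  -- When `ε₂ = 0` the high degrees of `A`, hence those of `d`, vanish, and the bound for low
  -- degrees suffices.
  · have hyz : ∀ n, y (N + n) = 0 := by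
      rw [← he, zero_pow two_ne_zero] at he2
      have hs := (FarField.summable_tail hy N).hasSum
      rw [he2] at hs
      exact congrFun ((hasSum_zero_iff_of_nonneg fun n => hy0 _).mp hs)
    have hxz : ∑' n, x (N + n) = 0 := by
      refine (tsum_congr fun n => ?_).trans tsum_zero
      have h := hxy (N + n)
      rw [hyz, mul_zero] at h
      exact (mul_eq_zero.mp h).resolve_left hT.ne'
    have hI : FarField.invEnergy k e = 0 := by simp [FarField.invEnergy, ← he]
    rw [hI]
    refine ⟨hfinish ?_, hfinish ?_, hfinish ?_⟩ <;> rw [hxz] <;> positivity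
  · have hE : 0 ≤ -Real.log e := neg_nonneg.mpr (Real.log_nonpos he0 hε)
    have hexp : e = Real.exp (-(-Real.log e)) := by rw [neg_neg, Real.exp_log he]
    have hI : FarField.invEnergy k e = 1 / (-Real.log e + k) := by
      rw [FarField.invEnergy, if_neg he.ne']
    have hsqrt : e ^ (1 / 2 : ℝ) = Real.exp (-(-Real.log e) / 2) := by
      rw [Real.rpow_def_of_pos he]
      ring_nf
    obtain ⟨h1, h2, h3⟩ := FarField.tail_estimates hk hR hkR hx0 hy0 hx hy hx2 hxy hM hN hE hexp
      he2 hD0 hD2 hκ0 hκ2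
    rw [hI, hsqrt]
    refine ⟨hfinish ?_, hfinish ?_, hfinish ?_⟩ <;> rw [mul_one_div] <;> assumption
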